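/- A vehicle (TaV) offloads one task in each time period $t=1,2,\dots$ to one of finitely many service vehicles (SeVs), the set $\mathcal N$ of which does not change (a single epoch). The task of period $t$ has size $x_t>0$; offloading it to $n\in\mathcal N$ takes the delay $d(t,n)=x_tu(t,n)$, with $0\le u(t,n)\le u_m$ almost surely for a constant $u_m>0$ (in particular $u_m=\sup_{t,n}u(t,n)$). The sizes $x_t$ are random and identically distributed over time (possibly with a continuous distribution), for each $n$ the $u(t,n)$ are identically distributed over time with mean $\mu_n$, and all the variables $x_t$, $u(t,n)$ ($t\ge1$, $n\in\mathcal N$) are independent. There is a single best SeV $a^*$, i.e. $\mu^*:=\mu_{a^*}<\mu_n$ for all $n\ne a^*$; put $\delta_n=(\mu_n-\mu^*)/u_m$. Let thresholds $x^-\le x^+$ with $\mathbb P\{x_t\le x^-\}>0$ be given, and put $\tilde x_t=\max\{\min(\frac{x_t-x^-}{x^+-x^-},1),0\}$ if $x^+>x^-$; if $x^+=x^-$, put $\tilde x_t=0$ for $x_t\le x^-$ and $\tilde x_t=1$ for $x_t>x^-$. The AVUCB algorithm with parameter $\beta>0$ chooses the SeV $a_t$ as follows. As long as some SeV has not been used,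 $a_t$ is one of the unused SeVs, and $t_{a_t}:=t$. Afterwards, $$a_t\in\arg\min_{n\in\mathcal N}\Big\{\bar u_{t-1,n}-\sqrt{\tfrac{\beta(1-\tilde x_t)\ln(t-t_n)}{k_{t-1,n}}}\Big\},$$ where $k_{t,n}$ is the number of periods $s\le t$ with $a_s=n$, and $\bar u_{t,n}$ is the average of the observed $d(s,n)/x_s$ over these periods. Ties, and the order of the first uses, are decided by an arbitrary fixed rule that depends only on the period and the set of admissible choices. Let $\beta=2u_m^2$. Then: (1) With $x^+\ge x^-$, for every SeV $n\ne a^*$, $$\mathbb E[k_{T,n}]\le\frac{8\ln T}{\delta_n^2}+O(1).$$ (2) With $x^+=x^-$, and if $\mathbb E[x_t]<\infty$, the learning regret $R_T=\mathbb E\big[\sum_{t=1}^Tx_t(u(t,a_t)-\mu^*)\big]$ satisfies $$R_T\le u_m\sum_{n\ne a^*}\Big[\frac{8\ln T\;\mathbb E[x_t\mid x_t\le x^-]}{\delta_n}+O(1)\Big].$$ Here $O(1)$ stands for a quantity bounded by a constant that does not depend on $T\ge1$. -/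

import Mathlib

open MeasureTheory ProbabilityTheory

noncomputable section

namespace AVUCB

/-- Normalized input data size, with lower threshold `xm` (`x⁻`) and upper threshold `xp` (`x⁺`).
When the two thresholds coincide it is the indicator of `xm < x`. -/
def normSize (xm xp x : ℝ) : ℝ :=
  if xp = xm then (if x ≤ xm then 0 else 1)
  else max (min ((x - xm) / (xp - xm)) 1) 0

/-- What the task vehicle remembers about each service vehicle `n`: the number `k n` of tasks
offloaded to it so far, the empirical mean `ubar n` of its bit offloading delay, and the time
period `occ n` of its first connection. -/
structure State (ι : Type*) where
  k : ι → ℕ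
  ubar : ι → ℝ
  occ : ι → ℕ

variable {ι : Type*}

/-- Before the first period no service vehicle has been connected. -/
def initState : State ι := ⟨fun _ => 0, fun _ => 0, fun _ => 0⟩

/-- Utility of service vehicle `n` in period `t`, for normalized size `xt` of the current task and
the state `s` at the end of period `t - 1`. -/
def utility (β : ℝ) (t : ℕ) (xt : ℝ) (s : State ι) (n : ι) : ℝ :=
  s.ubar n - √(β * (1 - xt) * Real.log ((t : ℝ) - (s.occ n : ℝ)) / (s.k n : ℝ))

open Classical in
/-- The service vehicles among which the algorithm may choose in period `t`: those that have not
been connected yet, if there are any, and otherwise the minimizers of the utility. -/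
def candidates [Fintype ι] (β : ℝ) (t : ℕ) (xt : ℝ) (s : State ι) : Finset ι :=
  if ∃ n, s.k n = 0 then Finset.univ.filter (fun n => s.k n = 0)
  else Finset.univ.filter (fun n => ∀ m, utility β t xt s n ≤ utility β t xt s m)

open Classical in
/-- Update at the end of period `t`, when a task of size `x` was offloaded to `a` and the total
delay `d` was observed. -/
def update (t : ℕ) (x d : ℝ) (a : ι) (s : State ι) : State ι :=
  if s.k a = 0 then
    { k := Function.update s.k a 1
      ubar := Function.update s.ubar a (d / x)
      occ := Function.update s.occ a t }
  else
    { k := Function.update s.k a (s.k a + 1)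
      ubar := Function.update s.ubar a ((s.ubar a * (s.k a : ℝ) + d / x) / ((s.k a : ℝ) + 1))
      occ := s.occ }

/-- The state at the end of period `t` (periods are numbered `1, 2, …`) when the tasks have sizes
`x t` and the bit offloading delays are `u t n`, so that offloading task `t` to `n` takes
`x t * u t n`. The rule `tie t S` picks one element of the set `S` of admissible choices. -/
def run [Fintype ι] (tie : ℕ → Finset ι → ι) (β xm xp : ℝ) (x : ℕ → ℝ) (u : ℕ → ι → ℝ) :
    ℕ → State ι
  | 0 => initState
  | t + 1 =>
    let s := run tie β xm xp x u t
    let a := tie (t + 1) (candidates β (t + 1) (normSize xm xp (x (t + 1))) s)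
    update (t + 1) (x (t + 1)) (x (t + 1) * u (t + 1) a) a s

/-- The service vehicle to which the task of period `t ≥ 1` is offloaded. -/
def action [Fintype ι] (tie : ℕ → Finset ι → ι) (β xm xp : ℝ) (x : ℕ → ℝ) (u : ℕ → ι → ℝ)
    (t : ℕ) : ι :=
  tie t (candidates β t (normSize xm xp (x t)) (run tie β xm xp x u (t - 1)))

variable {Ω : Type*} [MeasurableSpace Ω]

/-- `μ_n`, the expected bit offloading delay of `n` (the same in all periods). -/
def meanDelay (P : Measure Ω) (u : ℕ → ι → Ω → ℝ) (n : ι) : ℝ := ∫ ω, u 1 n ω ∂P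

/-- `δ_n = (μ_n - μ^*) / u_m`. -/
def gap (P : Measure Ω) (u : ℕ → ι → Ω → ℝ) (um : ℝ) (best n : ι) : ℝ :=
  (meanDelay P u n - meanDelay P u best) / um

/-- `𝔼[k_{T,n}]`, the expected number of tasks offloaded to `n` in the periods `1, …, T`. -/
def expectedCount [Fintype ι] (P : Measure Ω) (tie : ℕ → Finset ι → ι) (β xm xp : ℝ)
    (x : ℕ → Ω → ℝ) (u : ℕ → ι → Ω → ℝ) (T : ℕ) (n : ι) : ℝ :=
  ∫ ω, ((run tie β xm xp (fun t => x t ω) (fun t m => u t m ω) T).k n : ℝ) ∂P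

/-- The learning regret `R_T = 𝔼[∑_{t=1}^T x_t (u(t, a_t) - μ^*)]`. -/
def regret [Fintype ι] (P : Measure Ω) (tie : ℕ → Finset ι → ι) (β xm xp : ℝ)
    (x : ℕ → Ω → ℝ) (u : ℕ → ι → Ω → ℝ) (best : ι) (T : ℕ) : ℝ :=
  ∫ ω, ∑ t ∈ Finset.Icc 1 T,
    x t ω * (u t (action tie β xm xp (fun t => x t ω) (fun t m => u t m ω) t) ω
      - meanDelay P u best) ∂P

end AVUCB

end

/-!
The algorithm is a UCB policy whose confidence width is scaled by `√(1 - z)`, where `z ∈ [0, 1]` is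
the normalized task size: small tasks (`z = 0`) get the full UCB1 width, large ones (`z = 1`) are
offloaded greedily. Let `Δ = μ_n - μ^*` for a suboptimal `n`.

**Concentration.** Whether `n` is used in a period depends on the past and on the current task size,
hence not on its current delay. So the exponential of the sum of the deviations observed at the
first `j` uses of `n`, suitably compensated, is a supermartingale
(`lintegral_exp_capSum_le_one`), and Hoeffding's inequality holds for the average of the first `j`
observations, with one exceptional event for all periods in which this average is current
(`measureReal_deviation_le`).

**The best service vehicle is explored.** Greedy choices could neglect the best service vehicle after
unlucky first observations; the small tasks prevent this. Consider the second half of the periods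
`1, …, t`. Except with probability `O(t⁻³)`, all averages stay within the confidence radius
`√(2 u_m² ln (t / 4) / j)` there, and the UCB1 argument shows that all but `O(ln t)` of the small
tasks go to the best service vehicle. Their number is linear in `t` except with exponentially small
probability. Hence the best service vehicle has been used linearly often, and the probabilities that
its average is off by a fixed `ε` after `t` periods are summable (`summable_best_mean_error`).

**Counting.** Suppose `n` is used after the initial period. Then the average of `n` is off by `Δ / 4`,
or that of the best one is, or the confidence width of `n` exceeds `Δ / 2`; in the last case `z < 1`
and `n` has been used less than `8 ln T / δ_n²` times (`use_suboptimal`). The first case costs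
`O(1)` in expectation, because each value `j` of the number of earlier uses of `n` occurs at one use
only, and the probabilities of an inaccurate average are geometric in `j`. The second one costs
`O(1)` by the previous paragraph. This bounds `𝔼[k_{T,n}]` (`exists_expectedCount_le`); and as the
last case does not occur for large tasks, only `O(1)` of those go to `n`
(`exists_sum_measureReal_use_large_le`).

**Regret.** The delay `u(t, n)` is independent of the task size and of the choice in period `t`, so
only the gaps `Δ` contribute to the regret (`regret_eq`). For equal thresholds the choice depends on
the current task only through its class, small or large, so that within a class size and choice are
independent, and the expected total size offloaded to `n` is the expected number of tasks times the
mean size (`sum_integral_use_eq`). The small tasks contribute the logarithmic term, and the large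
ones a constant.
-/

noncomputable section

namespace AVUCB

/-! ### The run of the algorithm on a fixed sequence of sizes and delays -/

section Dynamics

variable {ι : Type*} [Fintype ι] [DecidableEq ι] (tie : ℕ → Finset ι → ι) (β xm xp : ℝ)
  (x : ℕ → ℝ) (u : ℕ → ι → ℝ)

omit [DecidableEq ι] in
theorem run_succ (t : ℕ) :
    run tie β xm xp x u (t + 1) =
      update (t + 1) (x (t + 1)) (x (t + 1) * u (t + 1) (action tie β xm xp x u (t + 1)))
        (action tie β xm xp x u (t + 1)) (run tie β xm xp x u t) := rfl

omit [DecidableEq ι] in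
theorem run_zero_k (n : ι) : (run tie β xm xp x u 0).k n = 0 := rfl

theorem run_succ_k (t : ℕ) (n : ι) :
    (run tie β xm xp x u (t + 1)).k n =
      (run tie β xm xp x u t).k n + if action tie β xm xp x u (t + 1) = n then 1 else 0 := by
  rw [run_succ, update]
  split_ifs with h0 h1 h1
  · subst h1; simp [h0]
  · simp [Ne.symm h1]
  · subst h1; simp
  · simp [Ne.symm h1]

theorem monotone_run_k (n : ι) : Monotone fun t => (run tie β xm xp x u t).k n :=
  monotone_nat_of_le_succ fun t => by rw [run_succ_k]; exact Nat.le_add_right _ _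

theorem run_k_le (t : ℕ) (n : ι) : (run tie β xm xp x u t).k n ≤ t := by
  induction t with
  | zero => exact le_rfl
  | succ t ih => rw [run_succ_k]; split_ifs <;> omega

/-- Summing a function of the number of earlier uses over the uses of `n` enumerates the
values `0, …, k_{T,n} - 1`: these numbers are distinct. -/
theorem sum_uses (φ : ℕ → ℝ) (n : ι) (T : ℕ) :
    (∑ t ∈ Finset.range T, if action tie β xm xp x u (t + 1) = n then
        φ ((run tie β xm xp x u t).k n) else 0) =
      ∑ j ∈ Finset.range ((run tie β xm xp x u T).k n), φ j := by
  induction T with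
  | zero => simp [run_zero_k]
  | succ T ih =>
    rw [Finset.sum_range_succ, ih, run_succ_k]
    split_ifs
    · rw [Finset.sum_range_succ]
    · simp

/-- The empirical mean is the average of the observed bit offloading delays. -/
theorem run_succ_mean {t : ℕ} (hx : 0 < x (t + 1)) (n : ι) :
    ((run tie β xm xp x u (t + 1)).k n : ℝ) * (run tie β xm xp x u (t + 1)).ubar n =
      ((run tie β xm xp x u t).k n : ℝ) * (run tie β xm xp x u t).ubar n +
        if action tie β xm xp x u (t + 1) = n then u (t + 1) n else 0 := by
  rw [run_succ, update]
  split_ifs with h0 h1 h1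
  · subst h1; simp [h0, hx.ne']
  · simp [Ne.symm h1]
  · subst h1
    have : ((run tie β xm xp x u t).k (action tie β xm xp x u (t + 1)) : ℝ) + 1 ≠ 0 := by
      positivity
    simp only [Function.update_self, Nat.cast_add, Nat.cast_one]
    field_simp
  · simp [Ne.symm h1]

/-- The deviations from `μ` of the delays observed at the first `j` uses of `n`, summed over those
of these uses that fall into the periods `1, …, T`. -/
def capSum (μ : ℝ) (n : ι) (j T : ℕ) : ℝ :=
  ∑ t ∈ Finset.range T,
    if action tie β xm xp x u (t + 1) = n ∧ (run tie β xm xp x u t).k n < j then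
      u (t + 1) n - μ else 0

theorem capSum_eq_of_k_le (hx : ∀ t, 0 < x (t + 1)) (μ : ℝ) (n : ι) (j : ℕ) (T : ℕ)
    (h : (run tie β xm xp x u T).k n ≤ j) :
    capSum tie β xm xp x u μ n j T =
      ((run tie β xm xp x u T).k n : ℝ) * ((run tie β xm xp x u T).ubar n - μ) := by
  induction T with
  | zero => simp [capSum, run_zero_k]
  | succ T ih =>
    have hm := run_succ_mean tie β xm xp x u (hx T) n
    have hk := run_succ_k tie β xm xp x u T n
    have ih' := ih (by omega)
    rw [capSum, Finset.sum_range_succ, ← capSum, ih', mul_sub, mul_sub, hm]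
    by_cases ha : action tie β xm xp x u (T + 1) = n
    · rw [if_pos ha] at hk
      rw [if_pos ⟨ha, by omega⟩, if_pos ha, hk]
      push_cast
      ring
    · rw [if_neg ha] at hk
      rw [if_neg (fun h => ha h.1), if_neg ha, hk]
      simp

theorem capSum_eq_of_k_eq (hx : ∀ t, 0 < x (t + 1)) (μ : ℝ) (n : ι) {t T : ℕ} (htT : t ≤ T) :
    capSum tie β xm xp x u μ n ((run tie β xm xp x u t).k n) T =
      ((run tie β xm xp x u t).k n : ℝ) * ((run tie β xm xp x u t).ubar n - μ) := by
  induction T, htT using Nat.le_induction with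
  | base => exact capSum_eq_of_k_le tie β xm xp x u hx μ n _ t le_rfl
  | succ T hT ih =>
    have hmono : (run tie β xm xp x u t).k n ≤ (run tie β xm xp x u T).k n :=
      monotone_run_k tie β xm xp x u n hT
    rw [capSum, Finset.sum_range_succ, ← capSum, ih, if_neg (fun h => absurd h.2 (by omega)),
      add_zero]

omit [DecidableEq ι] in
theorem candidates_nonempty [Nonempty ι] (t : ℕ) (z : ℝ) (s : State ι) :
    (candidates β t z s).Nonempty := by
  rw [candidates]
  split_ifs with h
  · obtain ⟨n, hn⟩ := h
    exact ⟨n, by simpa using hn⟩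
  · obtain ⟨n, -, hn⟩ := Finset.exists_min_image Finset.univ (utility β t z s)
      Finset.univ_nonempty
    exact ⟨n, by simpa using fun m => hn m (Finset.mem_univ m)⟩

variable (h_tie : ∀ t S, S.Nonempty → tie t S ∈ S)

include h_tie

omit [DecidableEq ι] in
theorem action_mem [Nonempty ι] (t : ℕ) :
    action tie β xm xp x u (t + 1) ∈
      candidates β (t + 1) (normSize xm xp (x (t + 1))) (run tie β xm xp x u t) :=
  h_tie _ _ (candidates_nonempty β _ _ _)

theorem used_or_le_card_used [Nonempty ι] (t : ℕ) :
    (∀ n, (run tie β xm xp x u t).k n ≠ 0) ∨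
      t ≤ (Finset.univ.filter fun n => (run tie β xm xp x u t).k n ≠ 0).card := by
  induction t with
  | zero => right; simp
  | succ t ih =>
    by_cases hall : ∀ n, (run tie β xm xp x u t).k n ≠ 0
    · left
      intro n
      have := hall n
      rw [run_succ_k]
      omega
    · right
      have ih' := ih.resolve_left hall
      push Not at hall
      have hmem := action_mem tie β xm xp x u h_tie t
      rw [candidates, if_pos hall] at hmem
      simp only [Finset.mem_filter, Finset.mem_univ, true_and] at hmem
      have hsub : insert (action tie β xm xp x u (t + 1))
          (Finset.univ.filter fun n => (run tie β xm xp x u t).k n ≠ 0) ⊆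
          Finset.univ.filter fun n => (run tie β xm xp x u (t + 1)).k n ≠ 0 := by
        intro n hn
        rw [Finset.mem_insert, Finset.mem_filter] at hn
        simp only [Finset.mem_filter, Finset.mem_univ, true_and, run_succ_k]
        rcases hn with rfl | hn
        · simp
        · have := hn.2
          omega
      refine le_trans ?_ (Finset.card_le_card hsub)
      rw [Finset.card_insert_of_notMem (by simp [hmem])]
      omega

theorem run_k_ne_zero [Nonempty ι] {t : ℕ} (ht : Fintype.card ι ≤ t) (n : ι) :
    (run tie β xm xp x u t).k n ≠ 0 := by
  rcases used_or_le_card_used tie β xm xp x u h_tie t with h | h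
  · exact h n
  · have hcard := (Finset.card_le_univ
      (Finset.univ.filter fun n => (run tie β xm xp x u t).k n ≠ 0))
    have : (Finset.univ.filter fun n => (run tie β xm xp x u t).k n ≠ 0) = Finset.univ :=
      Finset.eq_univ_of_card _ (by omega)
    have hn : n ∈ Finset.univ.filter fun n => (run tie β xm xp x u t).k n ≠ 0 := by simp [this]
    simpa using hn

theorem run_occ_le [Nonempty ι] (t : ℕ) (n : ι) :
    (run tie β xm xp x u t).occ n ≤ Fintype.card ι := by
  induction t with
  | zero => exact Nat.zero_le _
  | succ t ih =>
    rw [run_succ, update]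
    split_ifs with h0
    · have ht : t < Fintype.card ι := by
        by_contra hlt
        exact run_k_ne_zero tie β xm xp x u h_tie (not_lt.1 hlt) _ h0
      by_cases hn : n = action tie β xm xp x u (t + 1)
      · subst hn; simpa using ht
      · simpa [Function.update_apply, hn] using ih
    · exact ih

theorem utility_action_le [Nonempty ι] {t : ℕ} (ht : Fintype.card ι ≤ t) (m : ι) :
    utility β (t + 1 : ℕ) (normSize xm xp (x (t + 1))) (run tie β xm xp x u t)
        (action tie β xm xp x u (t + 1)) ≤
      utility β (t + 1 : ℕ) (normSize xm xp (x (t + 1))) (run tie β xm xp x u t) m := by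
  have hmem := action_mem tie β xm xp x u h_tie t
  have hne : ¬ ∃ n, (run tie β xm xp x u t).k n = 0 := by
    rintro ⟨n, hn⟩
    exact run_k_ne_zero tie β xm xp x u h_tie ht n hn
  rw [candidates, if_neg hne] at hmem
  simp only [Finset.mem_filter, Finset.mem_univ, true_and] at hmem
  exact hmem m

end Dynamics

/-! ### Measurability of the run, and independence of the past and the present -/

section Measurability

variable {ι : Type*} [Fintype ι] [DecidableEq ι] {Ω : Type*}

@[fun_prop]
theorem measurable_normSize (xm xp : ℝ) : Measurable (normSize xm xp) := by
  unfold normSize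
  split_ifs
  · exact Measurable.ite measurableSet_Iic measurable_const measurable_const
  · fun_prop

section Step

variable [MeasurableSpace Ω]

omit [DecidableEq ι] in
theorem measurableSet_mem_candidates (β : ℝ) (t : ℕ) {z : Ω → ℝ} (hz : Measurable z)
    {s : Ω → State ι} (hk : ∀ n, Measurable fun ω => (s ω).k n)
    (hu : ∀ n, Measurable fun ω => (s ω).ubar n) (ho : ∀ n, Measurable fun ω => (s ω).occ n)
    (n : ι) : MeasurableSet {ω | n ∈ candidates β t (z ω) (s ω)} := by
  have hutil : ∀ m, Measurable fun ω => utility β t (z ω) (s ω) m := by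
    intro m
    have h1 : Measurable fun ω => (((s ω).k m : ℕ) : ℝ) := measurable_from_nat.comp (hk m)
    have h2 : Measurable fun ω => (((s ω).occ m : ℕ) : ℝ) := measurable_from_nat.comp (ho m)
    have h3 := hu m
    unfold utility
    fun_prop
  have hzero : ∀ m, MeasurableSet {ω | (s ω).k m = 0} :=
    fun m => hk m (measurableSet_singleton 0)
  have heq : {ω | n ∈ candidates β t (z ω) (s ω)} =
      ((⋃ m, {ω | (s ω).k m = 0}) ∩ {ω | (s ω).k n = 0}) ∪
      ((⋃ m, {ω | (s ω).k m = 0})ᶜ ∩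
        ⋂ m, {ω | utility β t (z ω) (s ω) n ≤ utility β t (z ω) (s ω) m}) := by
    ext ω
    by_cases h : ∃ m, (s ω).k m = 0
    · simp [candidates, h]
    · simp only [candidates]
      push Not at h
      simp [h]
  rw [heq]
  have hU : MeasurableSet (⋃ m, {ω | (s ω).k m = 0}) := MeasurableSet.iUnion hzero
  exact (hU.inter (hzero n)).union (hU.compl.inter
    (MeasurableSet.iInter fun m => measurableSet_le (hutil n) (hutil m)))

omit [DecidableEq ι] in
theorem measurableSet_tie_candidates (tie : ℕ → Finset ι → ι) (β : ℝ) (t : ℕ) {z : Ω → ℝ}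
    (hz : Measurable z) {s : Ω → State ι} (hk : ∀ n, Measurable fun ω => (s ω).k n)
    (hu : ∀ n, Measurable fun ω => (s ω).ubar n) (ho : ∀ n, Measurable fun ω => (s ω).occ n)
    (n : ι) : MeasurableSet {ω | tie t (candidates β t (z ω) (s ω)) = n} := by
  have heq : {ω | tie t (candidates β t (z ω) (s ω)) = n} =
      ⋃ S : Finset ι, {ω | tie t S = n} ∩
        ⋂ m, {ω | m ∈ candidates β t (z ω) (s ω) ↔ m ∈ S} := by
    ext ω
    simp only [Set.mem_ofPred_eq, Set.mem_iUnion, Set.mem_inter_iff, Set.mem_iInter]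
    constructor
    · intro h
      exact ⟨_, h, fun _ => Iff.rfl⟩
    · rintro ⟨S, hS, h⟩
      rwa [Finset.ext h]
  rw [heq]
  refine MeasurableSet.iUnion fun S => (MeasurableSet.const _).inter
    (MeasurableSet.iInter fun m => ?_)
  have hm := measurableSet_mem_candidates β t hz hk hu ho m
  by_cases hS : m ∈ S
  · simp only [hS, iff_true]
    exact hm
  · simp only [hS, iff_false]
    exact hm.compl

end Step

omit [DecidableEq ι] in
/-- The pieces of the state after `t` periods are measurable for every σ-algebra for which the
sizes and delays of these periods are measurable. -/
theorem measurable_run (tie : ℕ → Finset ι → ι) (β xm xp : ℝ) (x : ℕ → Ω → ℝ)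
    (u : ℕ → ι → Ω → ℝ) (m : MeasurableSpace Ω) (t : ℕ) (hx : ∀ s ≤ t, Measurable (x s))
    (hu : ∀ s ≤ t, ∀ n, Measurable (u s n)) (n : ι) :
    (Measurable fun ω => (run tie β xm xp (fun s => x s ω) (fun s i => u s i ω) t).k n) ∧
    (Measurable fun ω => (run tie β xm xp (fun s => x s ω) (fun s i => u s i ω) t).ubar n) ∧
    (Measurable fun ω => (run tie β xm xp (fun s => x s ω) (fun s i => u s i ω) t).occ n) := by
  classical
  induction t generalizing n with
  | zero => exact ⟨measurable_const, measurable_const, measurable_const⟩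
  | succ t ih =>
    have ih' := ih (fun s hs => hx s (by omega)) (fun s hs => hu s (by omega))
    have hx1 := hx (t + 1) le_rfl
    have hu1 := hu (t + 1) le_rfl n
    have hz : Measurable fun ω => normSize xm xp (x (t + 1) ω) :=
      (measurable_normSize xm xp).comp hx1
    have hA : MeasurableSet {ω | action tie β xm xp (fun s => x s ω) (fun s i => u s i ω)
        (t + 1) = n} :=
      measurableSet_tie_candidates tie β (t + 1) hz (fun i => (ih' i).1)
        (fun i => (ih' i).2.1) (fun i => (ih' i).2.2) n
    obtain ⟨hk, hub, ho⟩ := ih' n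
    have hk0 : MeasurableSet {ω | (run tie β xm xp (fun s => x s ω) (fun s i => u s i ω) t).k n
        = 0} := hk (measurableSet_singleton 0)
    have hkR : Measurable fun ω =>
        (((run tie β xm xp (fun s => x s ω) (fun s i => u s i ω) t).k n : ℕ) : ℝ) :=
      measurable_from_nat.comp hk
    refine ⟨?_, ?_, ?_⟩
    · simp only [run_succ_k]
      exact hk.add (Measurable.ite hA measurable_const measurable_const)
    · have : (fun ω => (run tie β xm xp (fun s => x s ω) (fun s i => u s i ω) (t + 1)).ubar n) =
          fun ω => if action tie β xm xp (fun s => x s ω) (fun s i => u s i ω) (t + 1) = n then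
            (if (run tie β xm xp (fun s => x s ω) (fun s i => u s i ω) t).k n = 0 then
              x (t + 1) ω * u (t + 1) n ω / x (t + 1) ω
            else ((run tie β xm xp (fun s => x s ω) (fun s i => u s i ω) t).ubar n *
              ((run tie β xm xp (fun s => x s ω) (fun s i => u s i ω) t).k n : ℝ) +
              x (t + 1) ω * u (t + 1) n ω / x (t + 1) ω) /
              (((run tie β xm xp (fun s => x s ω) (fun s i => u s i ω) t).k n : ℝ) + 1))
          else (run tie β xm xp (fun s => x s ω) (fun s i => u s i ω) t).ubar n := by
        funext ω
        rw [run_succ, update]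
        split_ifs with h0 h1 h2 h1 h1 <;> grind
      rw [this]
      refine Measurable.ite hA (Measurable.ite hk0 (by fun_prop) (by fun_prop)) hub
    · have : (fun ω => (run tie β xm xp (fun s => x s ω) (fun s i => u s i ω) (t + 1)).occ n) =
          fun ω => if action tie β xm xp (fun s => x s ω) (fun s i => u s i ω) (t + 1) = n ∧
            (run tie β xm xp (fun s => x s ω) (fun s i => u s i ω) t).k n = 0 then t + 1
          else (run tie β xm xp (fun s => x s ω) (fun s i => u s i ω) t).occ n := by
        funext ω
        rw [run_succ, update]
        split_ifs with h0 h1 h1 <;> grind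
      rw [this]
      exact Measurable.ite (hA.inter hk0) measurable_const ho

omit [DecidableEq ι] in
/-- With the past and the current task size, the choice of period `t + 1` is determined. -/
theorem measurableSet_action_eq (tie : ℕ → Finset ι → ι) (β xm xp : ℝ) (x : ℕ → Ω → ℝ)
    (u : ℕ → ι → Ω → ℝ) (m : MeasurableSpace Ω) (t : ℕ) (hx : ∀ s ≤ t + 1, Measurable (x s))
    (hu : ∀ s ≤ t, ∀ n, Measurable (u s n)) (n : ι) :
    MeasurableSet {ω | action tie β xm xp (fun s => x s ω) (fun s i => u s i ω) (t + 1) = n} := by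
  classical
  have h := measurable_run tie β xm xp x u m t (fun s hs => hx s (by omega)) hu
  exact measurableSet_tie_candidates tie β (t + 1)
    ((measurable_normSize xm xp).comp (hx (t + 1) le_rfl)) (fun i => (h i).1)
    (fun i => (h i).2.1) (fun i => (h i).2.2) n

theorem measurable_capSum (tie : ℕ → Finset ι → ι) (β xm xp : ℝ) (x : ℕ → Ω → ℝ)
    (u : ℕ → ι → Ω → ℝ) (m : MeasurableSpace Ω) (t : ℕ) (hx : ∀ s ≤ t, Measurable (x s))
    (hu : ∀ s ≤ t, ∀ n, Measurable (u s n)) (μ : ℝ) (n : ι) (j : ℕ) :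
    Measurable fun ω => capSum tie β xm xp (fun s => x s ω) (fun s i => u s i ω) μ n j t := by
  unfold capSum
  refine Finset.measurable_fun_sum _ fun s hs => ?_
  rw [Finset.mem_range] at hs
  have hA := measurableSet_action_eq tie β xm xp x u m s (fun r hr => hx r (by omega))
    (fun r hr => hu r (by omega)) n
  have hk := (measurable_run tie β xm xp x u m s (fun r hr => hx r (by omega))
    (fun r hr => hu r (by omega)) n).1
  have hk' : MeasurableSet {ω | (run tie β xm xp (fun s => x s ω) (fun s i => u s i ω) s).k n
      < j} := hk measurableSet_Iio
  exact Measurable.ite (hA.inter hk') ((hu (s + 1) hs n).sub_const μ) measurable_const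

/-- The information carried by the variables with indices in `S`; here `(t, none)` stands for the
task size of period `t`, and `(t, some n)` for the bit offloading delay of `n` in period `t`. -/
abbrev info (x : ℕ → Ω → ℝ) (u : ℕ → ι → Ω → ℝ) (S : Set (ℕ × Option ι)) : MeasurableSpace Ω :=
  ⨆ p ∈ S, MeasurableSpace.comap (p.2.elim (x p.1) (u p.1)) inferInstance

omit [Fintype ι] [DecidableEq ι] in
theorem measurable_info_size (x : ℕ → Ω → ℝ) (u : ℕ → ι → Ω → ℝ) {S : Set (ℕ × Option ι)}
    {t : ℕ} (h : (t, none) ∈ S) : Measurable[info x u S] (x t) :=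
  Measurable.mono (comap_measurable (x t))
    (le_biSup (fun p : ℕ × Option ι => MeasurableSpace.comap (p.2.elim (x p.1) (u p.1))
      (inferInstance : MeasurableSpace ℝ)) h) le_rfl

omit [Fintype ι] [DecidableEq ι] in
theorem measurable_info_delay (x : ℕ → Ω → ℝ) (u : ℕ → ι → Ω → ℝ) {S : Set (ℕ × Option ι)}
    {t : ℕ} {n : ι} (h : (t, some n) ∈ S) : Measurable[info x u S] (u t n) :=
  Measurable.mono (comap_measurable (u t n))
    (le_biSup (fun p : ℕ × Option ι => MeasurableSpace.comap (p.2.elim (x p.1) (u p.1))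
      (inferInstance : MeasurableSpace ℝ)) h) le_rfl

section Indep

variable [mΩ : MeasurableSpace Ω] {P : Measure Ω} {x : ℕ → Ω → ℝ} {u : ℕ → ι → Ω → ℝ}
  (hx_meas : ∀ t, Measurable (x t)) (hu_meas : ∀ t n, Measurable (u t n))

include hx_meas hu_meas

omit [Fintype ι] [DecidableEq ι] in
theorem info_le (S : Set (ℕ × Option ι)) : info x u S ≤ mΩ := by
  refine iSup₂_le fun p _ => ?_
  rcases p with ⟨t, _ | n⟩
  · exact (hx_meas t).comap_le
  · exact (hu_meas t n).comap_le

omit [Fintype ι] [DecidableEq ι] in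
theorem indep_info (h_indep : iIndepFun (fun p : ℕ × Option ι => p.2.elim (x p.1) (u p.1)) P)
    {S T : Set (ℕ × Option ι)} (hST : Disjoint S T) : Indep (info x u S) (info x u T) P := by
  refine indep_iSup_of_disjoint (fun p => ?_) h_indep hST
  rcases p with ⟨t, _ | n⟩
  · exact (hx_meas t).comap_le
  · exact (hu_meas t n).comap_le

end Indep

end Measurability

/-! ### Concentration of the empirical means -/

section Concentration

variable {ι : Type*} [Fintype ι] [DecidableEq ι] {Ω : Type*} [mΩ : MeasurableSpace Ω]
  (P : Measure Ω) [IsProbabilityMeasure P] (tie : ℕ → Finset ι → ι) (β xm xp : ℝ)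
  (x : ℕ → Ω → ℝ) (u : ℕ → ι → Ω → ℝ)

/-- The event that, by period `T`, service vehicle `n` has been used `j` times and that the average
of the first `j` observed delays is off from `μ_n` by at least `c`. -/
def deviation (n : ι) (j : ℕ) (c : ℝ) (T : ℕ) : Set Ω :=
  {ω | j ≤ (run tie β xm xp (fun s => x s ω) (fun s i => u s i ω) T).k n ∧
    (j : ℝ) * c ≤
      |capSum tie β xm xp (fun s => x s ω) (fun s i => u s i ω) (meanDelay P u n) n j T|}

omit [IsProbabilityMeasure P] in
theorem mem_deviation {ω : Ω} (hx : ∀ t, 0 < x (t + 1) ω) (n : ι) {t T : ℕ} (htT : t ≤ T)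
    {c : ℝ}
    (hc : c ≤ |(run tie β xm xp (fun s => x s ω) (fun s i => u s i ω) t).ubar n
      - meanDelay P u n|) :
    ω ∈ deviation P tie β xm xp x u n
      ((run tie β xm xp (fun s => x s ω) (fun s i => u s i ω) t).k n) c T := by
  refine ⟨monotone_run_k _ _ _ _ _ _ _ htT, ?_⟩
  rw [capSum_eq_of_k_eq _ _ _ _ _ _ hx _ _ htT, abs_mul, Nat.abs_cast]
  gcongr

variable {x u} (hx_meas : ∀ t, Measurable (x t)) (hu_meas : ∀ t n, Measurable (u t n))

include hx_meas hu_meas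

omit [IsProbabilityMeasure P] in
theorem measurableSet_deviation (n : ι) (j : ℕ) (c : ℝ) (T : ℕ) :
    MeasurableSet (deviation P tie β xm xp x u n j c T) := by
  have h1 := (measurable_run tie β xm xp x u mΩ T (fun s _ => hx_meas s)
    (fun s _ => hu_meas s) n).1
  have h2 := measurable_capSum tie β xm xp x u mΩ T (fun s _ => hx_meas s)
    (fun s _ => hu_meas s) (meanDelay P u n) n j
  exact (h1 measurableSet_Ici).inter (measurableSet_le measurable_const h2.abs)

variable (h_indep : iIndepFun (fun p : ℕ × Option ι => p.2.elim (x p.1) (u p.1)) P)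
  (hu_ident : ∀ t n, IdentDistrib (u t n) (u 1 n) P P)
  {um : ℝ} (hum : 0 < um) (hu_bound : ∀ t n, ∀ᵐ ω ∂P, 0 ≤ u t n ω ∧ u t n ω ≤ um)

omit [Fintype ι] [DecidableEq ι] [IsProbabilityMeasure P] hx_meas hu_meas in
include hu_ident in
theorem integral_delay (t : ℕ) (n : ι) : ∫ ω, u t n ω ∂P = meanDelay P u n :=
  (hu_ident t n).integral_eq

omit [Fintype ι] [DecidableEq ι] hx_meas in
include hu_ident hu_bound in
/-- Hoeffding's lemma for one bit offloading delay. -/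
theorem lintegral_exp_delay_le_one (t : ℕ) (n : ι) (l : ℝ) :
    ∫⁻ ω, ENNReal.ofReal (Real.exp (l * (u t n ω - meanDelay P u n) - l ^ 2 * um ^ 2 / 8)) ∂P
      ≤ 1 := by
  have hsub := hasSubgaussianMGF_of_mem_Icc (μ := P) (X := u t n) (a := 0) (b := um)
    (hu_meas t n).aemeasurable (by
      filter_upwards [hu_bound t n] with ω h using ⟨h.1, h.2⟩)
  rw [integral_delay P hu_ident] at hsub
  have hint := hsub.integrable_exp_mul l
  have hm := hsub.mgf_le l
  have hc : (((‖um - 0‖₊ / 2) ^ 2 : NNReal) : ℝ) = um ^ 2 / 4 := by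
    simp only [sub_zero, NNReal.coe_pow, NNReal.coe_div, coe_nnnorm, Real.norm_eq_abs,
      div_pow, sq_abs, NNReal.coe_ofNat]
    ring
  rw [hc] at hm
  have heq : ∀ ω, Real.exp (l * (u t n ω - meanDelay P u n) - l ^ 2 * um ^ 2 / 8) =
      Real.exp (-(l ^ 2 * um ^ 2 / 8)) * Real.exp (l * (u t n ω - meanDelay P u n)) := by
    intro ω
    rw [← Real.exp_add]
    ring_nf
  simp_rw [heq]
  rw [← ofReal_integral_eq_lintegral_ofReal (hint.const_mul _)
    (Filter.Eventually.of_forall fun ω => by positivity), integral_const_mul]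
  rw [ENNReal.ofReal_le_one]
  calc _ ≤ Real.exp (-(l ^ 2 * um ^ 2 / 8)) * Real.exp (um ^ 2 / 4 * l ^ 2 / 2) := by
        gcongr
        exact hm
    _ = 1 := by
        rw [← Real.exp_add]
        convert Real.exp_zero using 2
        ring

include h_indep hu_ident hu_bound

/-- The exponential supermartingale of the first `j` uses of `n`: whether `n` is used in a period
is decided by the past and the current task size, hence independently of its current delay. -/
theorem lintegral_exp_capSum_le_one (n : ι) (j : ℕ) (l : ℝ) (T : ℕ) :
    ∫⁻ ω, ENNReal.ofReal (Real.exp (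
      l * capSum tie β xm xp (fun s => x s ω) (fun s i => u s i ω) (meanDelay P u n) n j T -
        l ^ 2 * um ^ 2 / 8 *
          (min ((run tie β xm xp (fun s => x s ω) (fun s i => u s i ω) T).k n) j : ℕ))) ∂P
      ≤ 1 := by
  induction T with
  | zero => simp [capSum, run_zero_k]
  | succ T ih =>
    set M : Ω → ENNReal := fun ω => ENNReal.ofReal (Real.exp (
      l * capSum tie β xm xp (fun s => x s ω) (fun s i => u s i ω) (meanDelay P u n) n j T -
        l ^ 2 * um ^ 2 / 8 *
          (min ((run tie β xm xp (fun s => x s ω) (fun s i => u s i ω) T).k n) j : ℕ))) with hM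
    set G : Set Ω := {ω | action tie β xm xp (fun s => x s ω) (fun s i => u s i ω) (T + 1) = n ∧
      (run tie β xm xp (fun s => x s ω) (fun s i => u s i ω) T).k n < j} with hG
    set E : Ω → ENNReal := fun ω => ENNReal.ofReal
      (Real.exp (l * (u (T + 1) n ω - meanDelay P u n) - l ^ 2 * um ^ 2 / 8)) with hE
    -- All that is known when the delay of `n` in period `T + 1` is drawn.
    set S : Set (ℕ × Option ι) := {p | p.1 ≤ T} ∪ {(T + 1, none)} with hS
    have hxS : ∀ s ≤ T + 1, Measurable[info x u S] (x s) := by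
      intro s hs
      apply measurable_info_size
      rcases Nat.le_succ_iff.1 hs with h | rfl
      · exact Or.inl h
      · exact Or.inr rfl
    have huS : ∀ s ≤ T, ∀ i, Measurable[info x u S] (u s i) :=
      fun s hs i => measurable_info_delay x u (Or.inl hs)
    have hkS := (measurable_run tie β xm xp x u (info x u S) T (fun s hs => hxS s (by omega))
      huS n).1
    have hcS := measurable_capSum tie β xm xp x u (info x u S) T (fun s hs => hxS s (by omega))
      huS (meanDelay P u n) n j
    have hGS : MeasurableSet[info x u S] G :=
      (measurableSet_action_eq tie β xm xp x u (info x u S) T hxS huS n).inter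
        (hkS measurableSet_Iio)
    have hMS : Measurable[info x u S] M := by
      have h1 : Measurable[info x u S] fun ω =>
          ((min ((run tie β xm xp (fun s => x s ω) (fun s i => u s i ω) T).k n) j : ℕ) : ℝ) :=
        (measurable_from_nat (f := fun k : ℕ => ((min k j : ℕ) : ℝ))).comp hkS
      exact ENNReal.measurable_ofReal.comp (Real.measurable_exp.comp
        ((hcS.const_mul l).sub (h1.const_mul _)))
    have hle := info_le hx_meas hu_meas S
    have hG' := hle _ hGS
    have hM' : Measurable M := hMS.mono hle le_rfl
    set S' : Set (ℕ × Option ι) := {(T + 1, some n)} with hS'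
    have hdisj : Disjoint S S' := by
      rw [Set.disjoint_singleton_right]
      rintro (h | h)
      · exact absurd h (by simp)
      · simp at h
    have hES : Measurable[info x u S'] E := by
      have hu1 : Measurable[info x u S'] (u (T + 1) n) := measurable_info_delay x u rfl
      exact ENNReal.measurable_ofReal.comp (Real.measurable_exp.comp
        (((hu1.sub_const _).const_mul l).sub_const _))
    have hstep : ∀ ω, ENNReal.ofReal (Real.exp (
      l * capSum tie β xm xp (fun s => x s ω) (fun s i => u s i ω) (meanDelay P u n) n j (T + 1) -
        l ^ 2 * um ^ 2 / 8 *
          (min ((run tie β xm xp (fun s => x s ω) (fun s i => u s i ω) (T + 1)).k n) j : ℕ))) =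
        Gᶜ.indicator M ω + G.indicator M ω * E ω := by
      intro ω
      rw [capSum, Finset.sum_range_succ, ← capSum, run_succ_k]
      by_cases hω : ω ∈ G
      · have hω' := hω
        rw [hG, Set.mem_ofPred_eq] at hω'
        rw [if_pos hω', if_pos hω'.1, Set.indicator_of_notMem (by simpa using hω),
          Set.indicator_of_mem hω, zero_add, hM, hE]
        simp only
        rw [← ENNReal.ofReal_mul (Real.exp_nonneg _), ← Real.exp_add]
        have h2 := hω'.2
        rw [min_eq_left (by omega), min_eq_left (by omega)]
        push_cast
        ring_nf
      · have hω' := hω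
        rw [hG, Set.mem_ofPred_eq] at hω'
        rw [if_neg hω', Set.indicator_of_mem (by simpa using hω), Set.indicator_of_notMem hω,
          zero_mul, add_zero, add_zero, hM]
        have hmin : min ((run tie β xm xp (fun s => x s ω) (fun s i => u s i ω) T).k n +
            if action tie β xm xp (fun s => x s ω) (fun s i => u s i ω) (T + 1) = n then 1 else 0) j
            = min ((run tie β xm xp (fun s => x s ω) (fun s i => u s i ω) T).k n) j := by
          split_ifs with ha
          · have : ¬ (run tie β xm xp (fun s => x s ω) (fun s i => u s i ω) T).k n < j :=
              fun h => hω' ⟨ha, h⟩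
            omega
          · simp
        rw [hmin]
    simp_rw [hstep]
    rw [lintegral_add_left (hM'.indicator hG'.compl)]
    rw [lintegral_mul_eq_lintegral_mul_lintegral_of_independent_measurableSpace hle
      (info_le hx_meas hu_meas S') (indep_info hx_meas hu_meas h_indep hdisj)
      (hMS.indicator hGS) hES]
    calc _ ≤ ∫⁻ ω, Gᶜ.indicator M ω ∂P + (∫⁻ ω, G.indicator M ω ∂P) * 1 := by
          gcongr
          exact lintegral_exp_delay_le_one P hu_meas hu_ident hu_bound (T + 1) n l
      _ = ∫⁻ ω, M ω ∂P := by
          rw [mul_one, lintegral_indicator hG'.compl, lintegral_indicator hG', add_comm,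
            lintegral_add_compl _ hG']
      _ ≤ 1 := ih

theorem measure_capSum_ge_le (n : ι) (j : ℕ) (l a : ℝ) (T : ℕ) :
    P {ω | j ≤ (run tie β xm xp (fun s => x s ω) (fun s i => u s i ω) T).k n ∧
      a ≤ l * capSum tie β xm xp (fun s => x s ω) (fun s i => u s i ω) (meanDelay P u n) n j T} ≤
      ENNReal.ofReal (Real.exp (l ^ 2 * um ^ 2 / 8 * j - a)) := by
  have h1 := lintegral_exp_capSum_le_one P tie β xm xp hx_meas hu_meas h_indep hu_ident
    hu_bound n j l T
  have hk := (measurable_run tie β xm xp x u mΩ T (fun s _ => hx_meas s)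
    (fun s _ => hu_meas s) n).1
  have hc := measurable_capSum tie β xm xp x u mΩ T (fun s _ => hx_meas s)
    (fun s _ => hu_meas s) (meanDelay P u n) n j
  have hkm : Measurable fun ω =>
      ((min ((run tie β xm xp (fun s => x s ω) (fun s i => u s i ω) T).k n) j : ℕ) : ℝ) :=
    (measurable_from_nat (f := fun k : ℕ => ((min k j : ℕ) : ℝ))).comp hk
  have h2 := mul_meas_ge_le_lintegral (μ := P) (f := fun ω => ENNReal.ofReal (Real.exp (
      l * capSum tie β xm xp (fun s => x s ω) (fun s i => u s i ω) (meanDelay P u n) n j T -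
        l ^ 2 * um ^ 2 / 8 *
          (min ((run tie β xm xp (fun s => x s ω) (fun s i => u s i ω) T).k n) j : ℕ))))
    (by fun_prop) (ENNReal.ofReal (Real.exp (a - l ^ 2 * um ^ 2 / 8 * j)))
  have hexp : ENNReal.ofReal (Real.exp (l ^ 2 * um ^ 2 / 8 * j - a)) =
      (ENNReal.ofReal (Real.exp (a - l ^ 2 * um ^ 2 / 8 * j)))⁻¹ := by
    rw [← ENNReal.ofReal_inv_of_pos (Real.exp_pos _), ← Real.exp_neg, neg_sub]
  rw [hexp, ENNReal.le_inv_iff_mul_le, mul_comm]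
  refine le_trans ?_ (h2.trans h1)
  refine mul_le_mul_right (measure_mono ?_) _
  rintro ω ⟨hj, ha⟩
  refine ENNReal.ofReal_le_ofReal (Real.exp_le_exp.2 ?_)
  rw [min_eq_right hj]
  linarith

include hum in
/-- Hoeffding's inequality for the average of the first `j` delays observed at `n`, uniformly over
the periods in which this average is the current one. -/
theorem measureReal_deviation_le (n : ι) (j : ℕ) {c : ℝ} (hc : 0 ≤ c) (T : ℕ) :
    P.real (deviation P tie β xm xp x u n j c T) ≤ 2 * Real.exp (-(2 * c ^ 2 / um ^ 2 * j)) := by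
  -- `|l| = 4 c / u_m²` optimizes the exponent; its two signs give the two tails.
  have key : ∀ l : ℝ, l ^ 2 = (4 * c / um ^ 2) ^ 2 →
      P.real {ω | j ≤ (run tie β xm xp (fun s => x s ω) (fun s i => u s i ω) T).k n ∧
        4 * c / um ^ 2 * (j * c) ≤
        l * capSum tie β xm xp (fun s => x s ω) (fun s i => u s i ω) (meanDelay P u n) n j T} ≤
      Real.exp (-(2 * c ^ 2 / um ^ 2 * j)) := by
    intro l hl
    have h := measure_capSum_ge_le P tie β xm xp hx_meas hu_meas h_indep hu_ident
      hu_bound n j l (4 * c / um ^ 2 * (j * c)) T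
    have he : l ^ 2 * um ^ 2 / 8 * j - 4 * c / um ^ 2 * (j * c) = -(2 * c ^ 2 / um ^ 2 * j) := by
      rw [hl]
      field_simp
      ring
    rw [he] at h
    exact ENNReal.toReal_le_of_le_ofReal (Real.exp_nonneg _) h
  have hl0 : 0 ≤ 4 * c / um ^ 2 := by positivity
  refine le_trans ?_ (le_trans (measureReal_union_le _ _)
    ((add_le_add (key _ rfl) (key _ (neg_sq _))).trans (two_mul _).ge))
  refine measureReal_mono ?_
  rintro ω ⟨hj, ha⟩
  rcases le_abs.1 ha with h | h
  · exact Or.inl ⟨hj, mul_le_mul_of_nonneg_left h hl0⟩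
  · refine Or.inr ⟨hj, ?_⟩
    have := mul_le_mul_of_nonneg_left h hl0
    simpa [neg_mul] using this

end Concentration

/-! ### Choices for small tasks -/

section LowTraffic

theorem normSize_nonneg (xm xp y : ℝ) : 0 ≤ normSize xm xp y := by
  unfold normSize
  split_ifs <;> simp

theorem normSize_le_one (xm xp y : ℝ) : normSize xm xp y ≤ 1 := by
  unfold normSize
  split_ifs <;> simp

theorem normSize_of_le {xm xp y : ℝ} (h : xm ≤ xp) (hy : y ≤ xm) : normSize xm xp y = 0 := by
  unfold normSize
  split_ifs
  · rfl
  · exact max_eq_right ((min_le_left _ _).trans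
      (div_nonpos_of_nonpos_of_nonneg (by linarith) (by linarith)))

theorem sum_range_lt_le (K : ℕ) {L : ℝ} (hL : 0 ≤ L) :
    (∑ j ∈ Finset.range K, if (j : ℝ) < L then (1 : ℝ) else 0) ≤ L + 1 := by
  rw [← Finset.sum_filter, Finset.sum_const, nsmul_eq_mul, mul_one]
  have hsub : (Finset.range K).filter (fun j : ℕ => (j : ℝ) < L) ⊆ Finset.range ⌈L⌉₊ := by
    intro j hj
    rw [Finset.mem_filter] at hj
    exact Finset.mem_range.2 (Nat.lt_ceil.2 hj.2)
  have hcard := Finset.card_le_card hsub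
  rw [Finset.card_range] at hcard
  calc _ ≤ (⌈L⌉₊ : ℝ) := by exact_mod_cast hcard
    _ ≤ L + 1 := (Nat.ceil_lt_add_one hL).le

variable {ι : Type*} [Fintype ι] [DecidableEq ι] {Ω : Type*} [mΩ : MeasurableSpace Ω]
  (P : Measure Ω) [IsProbabilityMeasure P] (tie : ℕ → Finset ι → ι) {xm xp : ℝ}
  (x : ℕ → Ω → ℝ) (u : ℕ → ι → Ω → ℝ)

/-- The confidence radius `√(2 u_m² ln (t / 4) / j)`; it undercuts the confidence widths that the
algorithm uses in a small-task period of the second half of `1, …, t`. -/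
def radius (um : ℝ) (t j : ℕ) : ℝ := √(2 * um ^ 2 * Real.log ((t : ℝ) / 4) / j)

variable (h_tie : ∀ t S, S.Nonempty → tie t S ∈ S) {um : ℝ} (hum : 0 < um) {best : ι}
  (h_best : ∀ n, n ≠ best → meanDelay P u best < meanDelay P u n)

include hum h_best in
omit [Fintype ι] [DecidableEq ι] [IsProbabilityMeasure P] in
theorem gap_pos {n : ι} (hn : n ≠ best) : 0 < gap P u um best n :=
  div_pos (sub_pos.2 (h_best n hn)) hum

variable (hxm : xm ≤ xp)

include h_tie hum h_best hxm

omit [IsProbabilityMeasure P] in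
/-- The UCB argument: if all averages are within their confidence radii, a suboptimal service
vehicle is used for a small task only while it has been used less than `8 ln t / δ²` times. -/
theorem run_k_lt_of_small_task {ω : Ω} (hx : ∀ t, 0 < x (t + 1) ω) {t s : ℕ}
    (ht : 4 * Fintype.card ι ≤ t) (hst : s < t) (hs : t / 2 ≤ s)
    (hdev : ∀ i, ∀ j, 1 ≤ j → j ≤ t →
      ω ∉ deviation P tie (2 * um ^ 2) xm xp x u i j (radius um t j) t)
    (hsmall : x (s + 1) ω ≤ xm) {m : ι} (hm : m ≠ best)
    (ha : action tie (2 * um ^ 2) xm xp (fun s => x s ω) (fun s i => u s i ω) (s + 1) = m) :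
    ((run tie (2 * um ^ 2) xm xp (fun s => x s ω) (fun s i => u s i ω) s).k m : ℝ) <
      8 * Real.log t / gap P u um best m ^ 2 := by
  have : Nonempty ι := ⟨best⟩
  have hN : 0 < Fintype.card ι := Fintype.card_pos
  have hNs : Fintype.card ι ≤ s := by omega
  set R := run tie (2 * um ^ 2) xm xp (fun s => x s ω) (fun s i => u s i ω) s with hR
  have hk1 : ∀ i, 1 ≤ R.k i := fun i =>
    Nat.one_le_iff_ne_zero.2 (run_k_ne_zero tie _ xm xp _ _ h_tie hNs i)
  have hkt : ∀ i, R.k i ≤ t := fun i => (run_k_le tie _ xm xp _ _ s i).trans hst.le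
  have hocc : ∀ i, R.occ i ≤ Fintype.card ι := run_occ_le tie _ xm xp _ _ h_tie s
  have hclose : ∀ i, |R.ubar i - meanDelay P u i| < radius um t (R.k i) := by
    intro i
    by_contra hc
    exact hdev i (R.k i) (hk1 i) (hkt i)
      (mem_deviation P tie _ xm xp x u hx i hst.le (not_lt.1 hc))
  have hutil := utility_action_le tie (2 * um ^ 2) xm xp (fun s => x s ω) (fun s i => u s i ω)
    h_tie hNs best
  rw [ha] at hutil
  simp only [normSize_of_le hxm hsmall, utility, ← hR, sub_zero, mul_one] at hutil
  have ht4 : (4 : ℝ) ≤ t := by exact_mod_cast (show 4 ≤ t by omega)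
  -- Every first use lies in the first `card ι ≤ t / 4` periods, and `s + 1 ≥ t / 2`.
  have hlow : ∀ i, (t : ℝ) / 4 ≤ ((s + 1 : ℕ) : ℝ) - R.occ i := by
    intro i
    have h1 := hocc i
    have h2 : t + 4 * R.occ i ≤ 4 * (s + 1) := by omega
    have h3 : (t : ℝ) + 4 * R.occ i ≤ 4 * ((s + 1 : ℕ) : ℝ) := by exact_mod_cast h2
    linarith
  have hwidth : ∀ i, radius um t (R.k i) ≤
      √(2 * um ^ 2 * Real.log (((s + 1 : ℕ) : ℝ) - R.occ i) / R.k i) := by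
    intro i
    apply Real.sqrt_le_sqrt
    have := Real.log_le_log (by linarith) (hlow i)
    gcongr
  have hwidth' : √(2 * um ^ 2 * Real.log (((s + 1 : ℕ) : ℝ) - R.occ m) / R.k m) ≤
      √(2 * um ^ 2 * Real.log t / R.k m) := by
    apply Real.sqrt_le_sqrt
    have h1 : ((s + 1 : ℕ) : ℝ) - R.occ m ≤ t := by
      have h2 : ((s + 1 : ℕ) : ℝ) ≤ t := by exact_mod_cast hst
      have h3 : (0 : ℝ) ≤ R.occ m := Nat.cast_nonneg _
      linarith
    have := Real.log_le_log (by linarith [hlow m]) h1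
    gcongr
  have h1 := abs_lt.1 (hclose m)
  have h2 := abs_lt.1 (hclose best)
  have hlt : meanDelay P u m - meanDelay P u best < 2 * √(2 * um ^ 2 * Real.log t / R.k m) := by
    linarith [hwidth m, hwidth best]
  have hg := gap_pos P u hum h_best hm
  have hgap : meanDelay P u m - meanDelay P u best = gap P u um best m * um := by
    rw [gap]; field_simp
  rw [hgap] at hlt
  have hkpos : (0 : ℝ) < R.k m := by exact_mod_cast hk1 m
  have hlogt : 0 ≤ Real.log t := Real.log_nonneg (by linarith)
  have hsq := pow_lt_pow_left₀ hlt (by positivity) two_ne_zero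
  rw [mul_pow, mul_pow, Real.sq_sqrt (by positivity)] at hsq
  rw [lt_div_iff₀ (by positivity)]
  have h4 : gap P u um best m ^ 2 * um ^ 2 * R.k m < 8 * um ^ 2 * Real.log t := by
    have := mul_lt_mul_of_pos_right hsq hkpos
    calc _ < _ := this
      _ = _ := by field_simp; ring
  have hum2 : 0 < um ^ 2 := by positivity
  nlinarith

omit [IsProbabilityMeasure P] in
/-- If all averages are within their confidence radii, then all but `O(ln t)` of the small tasks
of the second half of `1, …, t` are offloaded to the best service vehicle. -/
theorem card_small_tasks_le {ω : Ω} (hx : ∀ t, 0 < x (t + 1) ω) {t : ℕ}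
    (ht : 4 * Fintype.card ι ≤ t)
    (hdev : ∀ i, ∀ j, 1 ≤ j → j ≤ t →
      ω ∉ deviation P tie (2 * um ^ 2) xm xp x u i j (radius um t j) t) :
    (∑ s ∈ Finset.Ico (t / 2) t, if x (s + 1) ω ≤ xm then (1 : ℝ) else 0) ≤
      (run tie (2 * um ^ 2) xm xp (fun s => x s ω) (fun s i => u s i ω) t).k best +
      ∑ m ∈ Finset.univ.erase best, (8 * Real.log t / gap P u um best m ^ 2 + 1) := by
  set R := run tie (2 * um ^ 2) xm xp (fun s => x s ω) (fun s i => u s i ω) with hR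
  set A := action tie (2 * um ^ 2) xm xp (fun s => x s ω) (fun s i => u s i ω) with hA
  have hsubset : Finset.Ico (t / 2) t ⊆ Finset.range t := by
    intro s hs
    exact Finset.mem_range.2 (Finset.mem_Ico.1 hs).2
  have hpt : ∀ s ∈ Finset.Ico (t / 2) t, (if x (s + 1) ω ≤ xm then (1 : ℝ) else 0) ≤
      (if A (s + 1) = best then 1 else 0) + ∑ m ∈ Finset.univ.erase best,
        if A (s + 1) = m then
          (if ((R s).k m : ℝ) < 8 * Real.log t / gap P u um best m ^ 2 then (1 : ℝ) else 0)
        else 0 := by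
    intro s hs
    have hs' := Finset.mem_Ico.1 hs
    have hnn : ∀ m, (0 : ℝ) ≤ if A (s + 1) = m then
          (if ((R s).k m : ℝ) < 8 * Real.log t / gap P u um best m ^ 2 then (1 : ℝ) else 0)
        else 0 := by intro m; split_ifs <;> simp
    by_cases hsmall : x (s + 1) ω ≤ xm
    · rw [if_pos hsmall]
      by_cases hb : A (s + 1) = best
      · rw [if_pos hb]
        exact le_add_of_nonneg_right (Finset.sum_nonneg fun m _ => hnn m)
      · have hlt := run_k_lt_of_small_task P tie x u h_tie hum h_best hxm hx ht hs'.2 hs'.1 hdev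
          hsmall hb rfl
        rw [if_neg hb, zero_add]
        refine le_trans ?_ (Finset.single_le_sum (fun m _ => hnn m)
          (Finset.mem_erase.2 ⟨hb, Finset.mem_univ _⟩))
        rw [if_pos rfl, if_pos hlt]
    · rw [if_neg hsmall]
      exact add_nonneg (by split_ifs <;> simp) (Finset.sum_nonneg fun m _ => hnn m)
  refine (Finset.sum_le_sum hpt).trans ?_
  rw [Finset.sum_add_distrib, Finset.sum_comm]
  refine add_le_add ?_ (Finset.sum_le_sum fun m hm => ?_)
  · refine (Finset.sum_le_sum_of_subset_of_nonneg hsubset fun s _ _ => by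
      split_ifs <;> simp).trans ?_
    have := sum_uses tie (2 * um ^ 2) xm xp (fun s => x s ω) (fun s i => u s i ω) (fun _ => 1)
      best t
    rw [this]
    simp [hR]
  · refine (Finset.sum_le_sum_of_subset_of_nonneg hsubset fun s _ _ => by
      split_ifs <;> simp).trans ?_
    have := sum_uses tie (2 * um ^ 2) xm xp (fun s => x s ω) (fun s i => u s i ω)
      (fun j => if (j : ℝ) < 8 * Real.log t / gap P u um best m ^ 2 then (1 : ℝ) else 0) m t
    rw [this]
    exact sum_range_lt_le _ (div_nonneg (mul_nonneg (by norm_num) (Real.log_natCast_nonneg t))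
      (sq_nonneg _))

end LowTraffic

/-! ### The number of small tasks -/

section LowTrafficCount

variable {ι : Type*} {Ω : Type*} [mΩ : MeasurableSpace Ω] (P : Measure Ω) [IsProbabilityMeasure P]
  {xm : ℝ} {x : ℕ → Ω → ℝ} {u : ℕ → ι → Ω → ℝ} (hx_meas : ∀ t, Measurable (x t))
  (h_indep : iIndepFun (fun p : ℕ × Option ι => p.2.elim (x p.1) (u p.1)) P)
  (hx_ident : ∀ t, IdentDistrib (x t) (x 1) P P)

include hx_meas h_indep hx_ident

/-- Hoeffding's inequality for the number of small tasks in the second half of `1, …, t`. -/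
theorem measureReal_card_small_tasks_le {t : ℕ} (ht : 0 < t) :
    P.real {ω | (∑ s ∈ Finset.Ico (t / 2) t, if x (s + 1) ω ≤ xm then (1 : ℝ) else 0) <
      P.real {ω | x 1 ω ≤ xm} * t / 4} ≤
      Real.exp (-(P.real {ω | x 1 ω ≤ xm} ^ 2 / 8 * t)) := by
  set p := P.real {ω | x 1 ω ≤ xm} with hp
  have hp0 : 0 ≤ p := measureReal_nonneg
  -- The centred negative indicators of a small task have sum at least `p t / 4` on the event, as
  -- the second half of `1, …, t` contains at least `t / 2` periods.
  let f : ℝ → ℝ := fun y => (if y ≤ xm then (-1 : ℝ) else 0) + p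
  have hf : Measurable f :=
    (Measurable.ite measurableSet_Iic measurable_const measurable_const).add_const _
  have hind : iIndepFun (fun s : ℕ => fun ω => f (x (s + 1) ω)) P := by
    have h1 : iIndepFun (fun s : ℕ => x (s + 1)) P :=
      h_indep.precomp (g := fun s : ℕ => ((s + 1, none) : ℕ × Option ι))
        (fun a b h => by simpa using h)
    exact h1.comp (fun _ => f) (fun _ => hf)
  have hsub : ∀ s : ℕ, HasSubgaussianMGF (fun ω => f (x (s + 1) ω)) (1 / 4) P := by
    intro s
    have hset : MeasurableSet {ω | x (s + 1) ω ≤ xm} := hx_meas (s + 1) measurableSet_Iic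
    have hm : Measurable fun ω => if x (s + 1) ω ≤ xm then (-1 : ℝ) else 0 :=
      Measurable.ite hset measurable_const measurable_const
    have h1 := hasSubgaussianMGF_of_mem_Icc (μ := P)
      (X := fun ω => if x (s + 1) ω ≤ xm then (-1 : ℝ) else 0) (a := -1) (b := 0)
      hm.aemeasurable (Filter.Eventually.of_forall fun ω => by
        split_ifs <;> norm_num)
    have h2 : ∫ ω, (if x (s + 1) ω ≤ xm then (-1 : ℝ) else 0) ∂P = -p := by
      have h3 : (fun ω => if x (s + 1) ω ≤ xm then (-1 : ℝ) else 0) =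
          {ω | x (s + 1) ω ≤ xm}.indicator fun _ => (-1 : ℝ) := by
        ext ω; simp [Set.indicator_apply]
      rw [h3, integral_indicator_const _ hset, smul_eq_mul, mul_neg_one, hp, measureReal_def,
        measureReal_def]
      have h4 := (hx_ident (s + 1)).measure_mem_eq (measurableSet_Iic (a := xm))
      have h5 : P {ω | x (s + 1) ω ≤ xm} = P {ω | x 1 ω ≤ xm} := h4
      rw [h5]
    rw [h2] at h1
    simp only [sub_neg_eq_add] at h1
    convert h1 using 1
    ext
    norm_num
  have h := HasSubgaussianMGF.measure_sum_ge_le_of_iIndepFun hind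
    (s := Finset.Ico (t / 2) t) (c := fun _ => 1 / 4) (fun s _ => hsub s)
    (ε := p * t / 4) (by positivity)
  have hcard : ((Finset.Ico (t / 2) t).card : ℝ) = (t : ℝ) - (t / 2 : ℕ) := by
    rw [Nat.card_Ico, Nat.cast_sub (Nat.div_le_self _ _)]
  have hhalf : ((t / 2 : ℕ) : ℝ) ≤ t / 2 := Nat.cast_div_le
  have hhalf0 : (0 : ℝ) ≤ (t / 2 : ℕ) := Nat.cast_nonneg _
  have htpos : (0 : ℝ) < t := by exact_mod_cast ht
  refine (measureReal_mono ?_).trans (h.trans ?_)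
  · intro ω hω
    simp only [Set.mem_ofPred_eq] at hω ⊢
    rw [Finset.sum_add_distrib, Finset.sum_const, nsmul_eq_mul, hcard]
    have hneg : (∑ s ∈ Finset.Ico (t / 2) t, if x (s + 1) ω ≤ xm then (-1 : ℝ) else 0) =
        -∑ s ∈ Finset.Ico (t / 2) t, if x (s + 1) ω ≤ xm then (1 : ℝ) else 0 := by
      rw [← Finset.sum_neg_distrib]
      refine Finset.sum_congr rfl fun s _ => ?_
      split_ifs <;> simp
    rw [hneg]
    nlinarith
  · rw [Real.exp_le_exp]
    simp only [Finset.sum_const, nsmul_eq_mul]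
    push_cast
    rw [hcard, neg_div, neg_le_neg_iff, le_div_iff₀ (by linarith)]
    have : 0 ≤ p ^ 2 * t * (t / 2 : ℕ) := by positivity
    nlinarith

end LowTrafficCount

/-! ### Accuracy of the empirical mean of the best service vehicle -/

section BestMean

open Filter Asymptotics

theorem eventually_sum_log_le {ι : Type*} (S : Finset ι) (g : ι → ℝ) {c : ℝ} (hc : 0 < c) :
    ∀ᶠ t : ℕ in atTop, ∑ m ∈ S, (8 * Real.log t / g m ^ 2 + 1) ≤ c * t := by
  have h : (fun y : ℝ => ∑ m ∈ S, (8 * Real.log y / g m ^ 2 + 1)) =o[atTop] fun y : ℝ => y := by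
    refine IsLittleO.fun_sum fun m _ => IsLittleO.add ?_ (isLittleO_const_id_atTop (1 : ℝ))
    have := Real.isLittleO_log_id_atTop.const_mul_left (8 / g m ^ 2)
    refine this.congr_left fun y => ?_
    ring
  have h2 := (h.comp_tendsto tendsto_natCast_atTop_atTop).bound hc
  filter_upwards [h2] with t ht
  simp only [Function.comp_apply, Real.norm_eq_abs, Nat.abs_cast] at ht
  exact (le_abs_self _).trans ht

variable {ι : Type*} [Fintype ι] [DecidableEq ι] {Ω : Type*} [mΩ : MeasurableSpace Ω]
  (P : Measure Ω) [IsProbabilityMeasure P] (tie : ℕ → Finset ι → ι) {xm xp : ℝ}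
  {x : ℕ → Ω → ℝ} {u : ℕ → ι → Ω → ℝ}
  (hx_meas : ∀ t, Measurable (x t)) (hu_meas : ∀ t n, Measurable (u t n))
  (h_indep : iIndepFun (fun p : ℕ × Option ι => p.2.elim (x p.1) (u p.1)) P)
  (hx_ident : ∀ t, IdentDistrib (x t) (x 1) P P)
  (hu_ident : ∀ t n, IdentDistrib (u t n) (u 1 n) P P)
  (hx_pos : ∀ t, ∀ᵐ ω ∂P, 0 < x t ω)
  {um : ℝ} (hum : 0 < um) (hu_bound : ∀ t n, ∀ᵐ ω ∂P, 0 ≤ u t n ω ∧ u t n ω ≤ um)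
  {best : ι} (h_best : ∀ n, n ≠ best → meanDelay P u best < meanDelay P u n)
  (hxm : xm ≤ xp) (h_low : 0 < P {ω | x 1 ω ≤ xm})
  (h_tie : ∀ t S, S.Nonempty → tie t S ∈ S)

include hx_meas hu_meas h_indep hu_ident hum hu_bound

theorem measureReal_radius_exceeded_le {t : ℕ} (ht : 4 ≤ t) :
    P.real (⋃ i ∈ (Finset.univ : Finset ι), ⋃ j ∈ Finset.Icc 1 t,
      deviation P tie (2 * um ^ 2) xm xp x u i j (radius um t j) t) ≤
      512 * Fintype.card ι * ((t : ℝ) ^ 3)⁻¹ := by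
  have ht4 : (4 : ℝ) ≤ t := by exact_mod_cast ht
  have hterm : ∀ i, ∀ j ∈ Finset.Icc 1 t,
      P.real (deviation P tie (2 * um ^ 2) xm xp x u i j (radius um t j) t) ≤
        512 * ((t : ℝ) ^ 4)⁻¹ := by
    intro i j hj
    have hj1 : (0 : ℝ) < j := by exact_mod_cast (Finset.mem_Icc.1 hj).1
    have hlog : 0 ≤ Real.log ((t : ℝ) / 4) := Real.log_nonneg (by linarith)
    refine (measureReal_deviation_le P tie _ xm xp hx_meas hu_meas h_indep hu_ident hum hu_bound
      i j (Real.sqrt_nonneg _) t).trans ?_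
    rw [Real.sq_sqrt (by positivity)]
    -- For this radius Hoeffding's bound is `2 (t / 4)⁻⁴`, whatever `j` is.
    have he : -(2 * (2 * um ^ 2 * Real.log ((t : ℝ) / 4) / j) / um ^ 2 * j) =
        Real.log (((t : ℝ) / 4)⁻¹ ^ 4) := by
      rw [Real.log_pow, Real.log_inv]
      field_simp
      push_cast
      ring
    rw [he, Real.exp_log (by positivity)]
    apply le_of_eq
    field_simp
    norm_num
  calc _ ≤ ∑ i : ι, ∑ j ∈ Finset.Icc 1 t,
        P.real (deviation P tie (2 * um ^ 2) xm xp x u i j (radius um t j) t) :=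
        (measureReal_biUnion_finset_le _ _).trans
          (Finset.sum_le_sum fun i _ => measureReal_biUnion_finset_le _ _)
    _ ≤ ∑ i : ι, ∑ j ∈ Finset.Icc 1 t, 512 * ((t : ℝ) ^ 4)⁻¹ :=
        Finset.sum_le_sum fun i _ => Finset.sum_le_sum (hterm i)
    _ = _ := by
        simp only [Finset.sum_const, Nat.card_Icc, nsmul_eq_mul, Finset.card_univ]
        push_cast
        field_simp

theorem measureReal_late_deviation_le (n : ι) {ε : ℝ} (hε : 0 < ε) (c : ℝ) (t : ℕ) :
    P.real (⋃ j ∈ (Finset.range (t + 1)).filter (fun j : ℕ => c * t ≤ j),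
      deviation P tie (2 * um ^ 2) xm xp x u n j ε t) ≤
      2 * (t + 1) * Real.exp (-(2 * ε ^ 2 / um ^ 2 * c * t)) := by
  calc _ ≤ ∑ j ∈ (Finset.range (t + 1)).filter (fun j : ℕ => c * t ≤ j),
        P.real (deviation P tie (2 * um ^ 2) xm xp x u n j ε t) :=
        measureReal_biUnion_finset_le _ _
    _ ≤ ∑ j ∈ (Finset.range (t + 1)).filter (fun j : ℕ => c * t ≤ j),
        2 * Real.exp (-(2 * ε ^ 2 / um ^ 2 * c * t)) := by
        refine Finset.sum_le_sum fun j hj => ?_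
        refine (measureReal_deviation_le P tie _ xm xp hx_meas hu_meas h_indep hu_ident hum
          hu_bound n j hε.le t).trans ?_
        have := (Finset.mem_filter.1 hj).2
        rw [mul_assoc (2 * ε ^ 2 / um ^ 2)]
        gcongr
    _ ≤ _ := by
        rw [Finset.sum_const, nsmul_eq_mul]
        have hcard : (((Finset.range (t + 1)).filter (fun j : ℕ => c * t ≤ j)).card : ℝ) ≤ t + 1 := by
          have h := Finset.card_filter_le (Finset.range (t + 1)) (fun j : ℕ => c * t ≤ j)
          rw [Finset.card_range] at h
          exact_mod_cast h
        have := Real.exp_pos (-(2 * ε ^ 2 / um ^ 2 * c * t))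
        nlinarith

include hx_ident hx_pos h_best hxm h_low h_tie

/-- The best service vehicle is used linearly often, so its average is eventually accurate: the
probabilities that it is off by `ε` are summable. -/
theorem summable_best_mean_error {ε : ℝ} (hε : 0 < ε) :
    Summable fun t : ℕ => P.real {ω | ε ≤
      |(run tie (2 * um ^ 2) xm xp (fun s => x s ω) (fun s i => u s i ω) t).ubar best -
        meanDelay P u best|} := by
  set p := P.real {ω | x 1 ω ≤ xm} with hp
  have hp0 : 0 < p := ENNReal.toReal_pos h_low.ne' (measure_ne_top _ _)
  have hx : ∀ᵐ ω ∂P, ∀ t, 0 < x (t + 1) ω := ae_all_iff.2 fun t => hx_pos (t + 1)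
  have hκ : 0 < 2 * ε ^ 2 / um ^ 2 * (p / 8) := by positivity
  set bound : ℕ → ℝ := fun t => 512 * Fintype.card ι * ((t : ℝ) ^ 3)⁻¹ +
    Real.exp (-(p ^ 2 / 8 * t)) +
    2 * (t + 1) * Real.exp (-(2 * ε ^ 2 / um ^ 2 * (p / 8) * t)) with hbound
  have hsum : Summable bound := by
    refine Summable.add (Summable.add ?_ ?_) ?_
    · exact (Real.summable_nat_pow_inv.2 (by norm_num)).mul_left _
    · have h := Real.summable_pow_mul_exp_neg_nat_mul 0 (r := p ^ 2 / 8) (by positivity)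
      refine h.congr fun t => ?_
      rw [pow_zero, one_mul, neg_mul]
    · have h1 := Real.summable_pow_mul_exp_neg_nat_mul 1 hκ
      have h0 := Real.summable_pow_mul_exp_neg_nat_mul 0 hκ
      refine ((h1.add h0).mul_left 2).congr fun t => ?_
      rw [pow_zero, pow_one, one_mul, neg_mul]
      ring
  refine Summable.of_norm_bounded_eventually_nat hsum ?_
  filter_upwards [eventually_sum_log_le (Finset.univ.erase best) (gap P u um best)
    (c := p / 8) (by positivity), eventually_ge_atTop (4 * Fintype.card ι)] with t hlog ht
  have : Nonempty ι := ⟨best⟩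
  have hN : 0 < Fintype.card ι := Fintype.card_pos
  rw [Real.norm_of_nonneg measureReal_nonneg]
  -- Off `B₁ ∪ B₂` the best service vehicle has been used at least `p t / 8` times: there are at
  -- least `p t / 4` small tasks in the second half, and at most `p t / 8` of them go elsewhere.
  set B₁ := ⋃ i ∈ (Finset.univ : Finset ι), ⋃ j ∈ Finset.Icc 1 t,
      deviation P tie (2 * um ^ 2) xm xp x u i j (radius um t j) t with hB₁
  set B₂ := {ω | (∑ s ∈ Finset.Ico (t / 2) t, if x (s + 1) ω ≤ xm then (1 : ℝ) else 0) <
      p * t / 4} with hB₂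
  set B₃ := ⋃ j ∈ (Finset.range (t + 1)).filter (fun j : ℕ => p / 8 * t ≤ j),
      deviation P tie (2 * um ^ 2) xm xp x u best j ε t with hB₃
  have hcover : ∀ᵐ ω ∂P, ω ∈ {ω | ε ≤
      |(run tie (2 * um ^ 2) xm xp (fun s => x s ω) (fun s i => u s i ω) t).ubar best -
        meanDelay P u best|} → ω ∈ B₁ ∪ B₂ ∪ B₃ := by
    filter_upwards [hx] with ω hxω hω
    by_contra hnot
    simp only [Set.mem_union, not_or] at hnot
    obtain ⟨⟨h1, h2⟩, h3⟩ := hnot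
    have hdev : ∀ i, ∀ j, 1 ≤ j → j ≤ t →
        ω ∉ deviation P tie (2 * um ^ 2) xm xp x u i j (radius um t j) t := by
      intro i j hj1 hjt hmem
      exact h1 (Set.mem_biUnion (Finset.mem_coe.2 (Finset.mem_univ i))
        (Set.mem_biUnion (Finset.mem_coe.2 (Finset.mem_Icc.2 ⟨hj1, hjt⟩)) hmem))
    have hcard := card_small_tasks_le P tie x u h_tie hum h_best hxm hxω ht hdev
    have h2' : p * t / 4 ≤ ∑ s ∈ Finset.Ico (t / 2) t, if x (s + 1) ω ≤ xm then (1 : ℝ) else 0 :=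
      not_lt.1 h2
    have hk : p / 8 * t ≤
        (run tie (2 * um ^ 2) xm xp (fun s => x s ω) (fun s i => u s i ω) t).k best := by
      linarith
    refine h3 (Set.mem_biUnion (Finset.mem_coe.2 (Finset.mem_filter.2 ⟨?_, hk⟩))
      (mem_deviation P tie _ xm xp x u hxω best le_rfl hω))
    exact Finset.mem_range.2 (Nat.lt_succ_of_le (run_k_le _ _ _ _ _ _ _ _))
  calc _ ≤ P.real (B₁ ∪ B₂ ∪ B₃) :=
        ENNReal.toReal_mono (measure_ne_top _ _) (measure_mono_ae hcover)
    _ ≤ P.real B₁ + P.real B₂ + P.real B₃ :=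
        (measureReal_union_le _ _).trans (add_le_add_left (measureReal_union_le _ _) _)
    _ ≤ bound t := by
        refine add_le_add (add_le_add ?_ ?_) ?_
        · exact measureReal_radius_exceeded_le P tie hx_meas hu_meas h_indep hu_ident hum hu_bound
            (by omega)
        · exact measureReal_card_small_tasks_le P hx_meas h_indep hx_ident (by omega)
        · exact measureReal_late_deviation_le P tie hx_meas hu_meas h_indep hu_ident hum hu_bound
            best hε _ t

end BestMean

/-! ### Counting the uses of a suboptimal service vehicle -/

section Counting

variable {ι : Type*} [Fintype ι] [DecidableEq ι] {Ω : Type*} [mΩ : MeasurableSpace Ω]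
  (P : Measure Ω) [IsProbabilityMeasure P] (tie : ℕ → Finset ι → ι) (xm xp : ℝ)
  (x : ℕ → Ω → ℝ) (u : ℕ → ι → Ω → ℝ) {um : ℝ} (hum : 0 < um) {best : ι}

/-- The event that the average of the best service vehicle after `t` periods is off from its mean
by at least `ε`. -/
def bestMeanError (um : ℝ) (best : ι) (ε : ℝ) (t : ℕ) : Set Ω :=
  {ω | ε ≤ |(run tie (2 * um ^ 2) xm xp (fun s => x s ω) (fun s i => u s i ω) t).ubar best -
    meanDelay P u best|}

/-- A bound for the number of uses of `n` in the periods `1, …, T` that its confidence width does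
not explain: the initial period, the inaccurate averages of `n`, each of which misleads at most one
choice, and the inaccurate averages of the best service vehicle. -/
def errorCount (um : ℝ) (best n : ι) (T : ℕ) (ω : Ω) : ℝ :=
  Fintype.card ι +
    ∑ j ∈ Finset.range T, (deviation P tie (2 * um ^ 2) xm xp x u n j
      ((meanDelay P u n - meanDelay P u best) / 4) T).indicator 1 ω +
    ∑ t ∈ Finset.range T, (bestMeanError P tie xm xp x u um best
      ((meanDelay P u n - meanDelay P u best) / 4) t).indicator 1 ω

variable {xm xp x u}
variable (h_best : ∀ n, n ≠ best → meanDelay P u best < meanDelay P u n)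
  (h_tie : ∀ t S, S.Nonempty → tie t S ∈ S)

include hum h_best h_tie

omit [IsProbabilityMeasure P] in
/-- When a suboptimal service vehicle is used after the initial period, its average or that of the
best one is inaccurate, or it is still rarely used and the task is not of the largest size class. -/
theorem use_suboptimal {ω : Ω} {t : ℕ} (ht : Fintype.card ι ≤ t) {n : ι} (hn : n ≠ best)
    (ha : action tie (2 * um ^ 2) xm xp (fun s => x s ω) (fun s i => u s i ω) (t + 1) = n) :
    (meanDelay P u n - meanDelay P u best) / 4 ≤
      |(run tie (2 * um ^ 2) xm xp (fun s => x s ω) (fun s i => u s i ω) t).ubar n -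
        meanDelay P u n| ∨
    ω ∈ bestMeanError P tie xm xp x u um best ((meanDelay P u n - meanDelay P u best) / 4) t ∨
    (normSize xm xp (x (t + 1) ω) < 1 ∧
      ((run tie (2 * um ^ 2) xm xp (fun s => x s ω) (fun s i => u s i ω) t).k n : ℝ) <
        8 * Real.log (t + 1 : ℕ) / gap P u um best n ^ 2) := by
  have : Nonempty ι := ⟨best⟩
  by_contra hnot
  push Not at hnot
  obtain ⟨h1, h2, h3⟩ := hnot
  have h2 : |(run tie (2 * um ^ 2) xm xp (fun s => x s ω) (fun s i => u s i ω) t).ubar best -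
      meanDelay P u best| < (meanDelay P u n - meanDelay P u best) / 4 := not_le.1 h2
  have hutil := utility_action_le tie (2 * um ^ 2) xm xp (fun s => x s ω) (fun s i => u s i ω)
    h_tie ht best
  rw [ha] at hutil
  set R := run tie (2 * um ^ 2) xm xp (fun s => x s ω) (fun s i => u s i ω) t with hR
  have hk1 : 1 ≤ R.k n :=
    Nat.one_le_iff_ne_zero.2 (run_k_ne_zero tie _ xm xp _ _ h_tie ht n)
  have hocc : R.occ n ≤ Fintype.card ι := run_occ_le tie _ xm xp _ _ h_tie t n
  simp only [utility] at hutil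
  set z := normSize xm xp (x (t + 1) ω) with hz
  have hz0 : 0 ≤ z := normSize_nonneg _ _ _
  have hz1 : z ≤ 1 := normSize_le_one _ _ _
  have hwb : 0 ≤ √(2 * um ^ 2 * (1 - z) * Real.log (((t + 1 : ℕ) : ℝ) - R.occ best) / R.k best) :=
    Real.sqrt_nonneg _
  have h1' := abs_lt.1 h1
  have h2' := abs_lt.1 h2
  set w := √(2 * um ^ 2 * (1 - z) * Real.log (((t + 1 : ℕ) : ℝ) - R.occ n) / R.k n) with hw
  have hΔ : 0 < meanDelay P u n - meanDelay P u best := sub_pos.2 (h_best n hn)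
  -- With both averages accurate to a quarter of the gap, only a confidence width of more than half
  -- the gap can make `n` look at least as good as the best one.
  have hlt : (meanDelay P u n - meanDelay P u best) / 2 < w := by linarith
  -- For `z = 1` the width is zero.
  have hzlt : z < 1 := by
    rcases hz1.lt_or_eq with h | h
    · exact h
    · rw [hw, h] at hlt
      simp at hlt
      linarith
  refine absurd (h3 hzlt) (not_le.2 ?_)
  have hkpos : (0 : ℝ) < R.k n := by exact_mod_cast hk1
  have hdiff : (1 : ℝ) ≤ ((t + 1 : ℕ) : ℝ) - R.occ n := by
    have : ((R.occ n + 1 : ℕ) : ℝ) ≤ ((t + 1 : ℕ) : ℝ) := by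
      exact_mod_cast (show R.occ n + 1 ≤ t + 1 by omega)
    push_cast at this ⊢
    linarith
  have hlog0 : 0 ≤ Real.log (((t + 1 : ℕ) : ℝ) - R.occ n) := Real.log_nonneg hdiff
  have hlog : Real.log (((t + 1 : ℕ) : ℝ) - R.occ n) ≤ Real.log (t + 1 : ℕ) := by
    apply Real.log_le_log (by linarith)
    have : (0 : ℝ) ≤ R.occ n := Nat.cast_nonneg _
    linarith
  have hw' : w ^ 2 ≤ 2 * um ^ 2 * Real.log (t + 1 : ℕ) / R.k n := by
    have h1z : 0 ≤ 1 - z := by linarith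
    rw [hw, Real.sq_sqrt (by positivity)]
    have : (1 - z) * Real.log (((t + 1 : ℕ) : ℝ) - R.occ n) ≤ Real.log (t + 1 : ℕ) := by
      nlinarith
    rw [mul_assoc (2 * um ^ 2)]
    gcongr
  have hgap : meanDelay P u n - meanDelay P u best = gap P u um best n * um := by
    rw [gap]; field_simp
  have hg := gap_pos P u hum h_best hn
  rw [hgap] at hlt
  have hsq := (pow_lt_pow_left₀ hlt (by positivity) two_ne_zero).trans_le hw'
  rw [lt_div_iff₀ hkpos] at hsq
  rw [lt_div_iff₀ (by positivity)]
  have hum2 : 0 < um ^ 2 := by positivity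
  have hsq' : (R.k n * gap P u um best n ^ 2) * um ^ 2 <
      (8 * Real.log (t + 1 : ℕ)) * um ^ 2 := by
    calc _ = 4 * ((gap P u um best n * um / 2) ^ 2 * R.k n) := by ring
      _ < 4 * (2 * um ^ 2 * Real.log (t + 1 : ℕ)) := by linarith
      _ = _ := by ring
  exact lt_of_mul_lt_mul_right hsq' hum2.le

omit [IsProbabilityMeasure P] in
theorem card_unexplained_uses_le {ω : Ω} (hx : ∀ t, 0 < x (t + 1) ω) {n : ι} (hn : n ≠ best)
    (T : ℕ) :
    (∑ t ∈ Finset.range T,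
      if action tie (2 * um ^ 2) xm xp (fun s => x s ω) (fun s i => u s i ω) (t + 1) = n ∧
        ¬ (normSize xm xp (x (t + 1) ω) < 1 ∧
          ((run tie (2 * um ^ 2) xm xp (fun s => x s ω) (fun s i => u s i ω) t).k n : ℝ) <
            8 * Real.log T / gap P u um best n ^ 2) then (1 : ℝ) else 0) ≤
      errorCount P tie xm xp x u um best n T ω := by
  set R := run tie (2 * um ^ 2) xm xp (fun s => x s ω) (fun s i => u s i ω) with hR
  set A := action tie (2 * um ^ 2) xm xp (fun s => x s ω) (fun s i => u s i ω) with hA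
  set c := (meanDelay P u n - meanDelay P u best) / 4 with hc
  have h0 : ∀ s : Set Ω, (0 : ℝ) ≤ s.indicator 1 ω :=
    fun s => Set.indicator_nonneg (fun _ _ => zero_le_one) ω
  have hpt : ∀ t ∈ Finset.range T, (if A (t + 1) = n ∧
        ¬ (normSize xm xp (x (t + 1) ω) < 1 ∧
          ((R t).k n : ℝ) < 8 * Real.log T / gap P u um best n ^ 2) then (1 : ℝ) else 0) ≤
      (if t < Fintype.card ι then (1 : ℝ) else 0) +
      (if A (t + 1) = n then
        (deviation P tie (2 * um ^ 2) xm xp x u n ((R t).k n) c T).indicator 1 ω else 0) +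
      (bestMeanError P tie xm xp x u um best c t).indicator 1 ω := by
    intro t ht
    have htT : t < T := Finset.mem_range.1 ht
    have hnn1 : (0 : ℝ) ≤ if t < Fintype.card ι then (1 : ℝ) else 0 := by split_ifs <;> simp
    have hnn2 : (0 : ℝ) ≤ if A (t + 1) = n then
        (deviation P tie (2 * um ^ 2) xm xp x u n ((R t).k n) c T).indicator 1 ω else 0 := by
      split_ifs
      · exact h0 _
      · exact le_rfl
    have hnn3 := h0 (bestMeanError P tie xm xp x u um best c t)
    by_cases hif : A (t + 1) = n ∧ ¬ (normSize xm xp (x (t + 1) ω) < 1 ∧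
        ((R t).k n : ℝ) < 8 * Real.log T / gap P u um best n ^ 2)
    · rw [if_pos hif]
      by_cases htN : t < Fintype.card ι
      · rw [if_pos htN] at hnn1 ⊢
        linarith
      · have hlogT : Real.log (t + 1 : ℕ) ≤ Real.log T :=
          Real.log_le_log (by positivity) (by exact_mod_cast htT)
        rcases use_suboptimal P tie hum h_best h_tie (not_lt.1 htN) hn hif.1 with h | h | h
        · have hmem := mem_deviation P tie (2 * um ^ 2) xm xp x u hx n htT.le h
          rw [if_pos hif.1, Set.indicator_of_mem hmem, Pi.one_apply] at hnn2 ⊢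
          linarith
        · rw [Set.indicator_of_mem h, Pi.one_apply]
          linarith
        · refine absurd ⟨h.1, h.2.trans_le ?_⟩ hif.2
          have hg := gap_pos P u hum h_best hn
          gcongr
    · rw [if_neg hif]
      linarith
  refine (Finset.sum_le_sum hpt).trans ?_
  rw [Finset.sum_add_distrib, Finset.sum_add_distrib, errorCount]
  refine add_le_add (add_le_add ?_ ?_) le_rfl
  · rw [← Finset.sum_filter, Finset.sum_const, nsmul_eq_mul, mul_one]
    have hsub : (Finset.range T).filter (fun t => t < Fintype.card ι) ⊆
        Finset.range (Fintype.card ι) := by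
      intro t ht
      exact Finset.mem_range.2 (Finset.mem_filter.1 ht).2
    have h := Finset.card_le_card hsub
    rw [Finset.card_range] at h
    exact_mod_cast h
  · have h := sum_uses tie (2 * um ^ 2) xm xp (fun s => x s ω) (fun s i => u s i ω)
      (fun j => (deviation P tie (2 * um ^ 2) xm xp x u n j c T).indicator 1 ω) n T
    rw [h]
    refine Finset.sum_le_sum_of_subset_of_nonneg ?_ fun j _ _ => h0 _
    exact Finset.range_subset_range.2 (run_k_le _ _ _ _ _ _ _ _)

omit [IsProbabilityMeasure P] in
theorem run_k_le_errorCount {ω : Ω} (hx : ∀ t, 0 < x (t + 1) ω) {n : ι} (hn : n ≠ best)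
    (T : ℕ) :
    ((run tie (2 * um ^ 2) xm xp (fun s => x s ω) (fun s i => u s i ω) T).k n : ℝ) ≤
      errorCount P tie xm xp x u um best n T ω + (8 * Real.log T / gap P u um best n ^ 2 + 1) := by
  set L := 8 * Real.log T / gap P u um best n ^ 2 with hL
  have hL0 : 0 ≤ L := div_nonneg (mul_nonneg (by norm_num) (Real.log_natCast_nonneg T))
    (sq_nonneg _)
  have h1 := sum_uses tie (2 * um ^ 2) xm xp (fun s => x s ω) (fun s i => u s i ω)
    (fun _ => 1) n T
  have h2 := sum_uses tie (2 * um ^ 2) xm xp (fun s => x s ω) (fun s i => u s i ω)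
    (fun j => if (j : ℝ) < L then 1 else 0) n T
  rw [Finset.sum_const, Finset.card_range, nsmul_eq_mul, mul_one] at h1
  rw [← h1]
  refine le_trans ?_ (add_le_add (card_unexplained_uses_le P tie hum h_best h_tie hx hn T)
    (h2.le.trans (sum_range_lt_le _ hL0)))
  rw [← Finset.sum_add_distrib]
  refine Finset.sum_le_sum fun t _ => ?_
  rw [← hL]
  split_ifs with h3 h4 h5 h6 h7 <;> first | (exfalso; tauto) | norm_num

end Counting

/-! ### The expected number of uses -/

section Expectation

variable {ι : Type*} [Fintype ι] [DecidableEq ι] {Ω : Type*} [mΩ : MeasurableSpace Ω]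
  (P : Measure Ω) [IsProbabilityMeasure P] (tie : ℕ → Finset ι → ι) {xm xp : ℝ}
  {x : ℕ → Ω → ℝ} {u : ℕ → ι → Ω → ℝ}
  (hx_meas : ∀ t, Measurable (x t)) (hu_meas : ∀ t n, Measurable (u t n))
  (h_indep : iIndepFun (fun p : ℕ × Option ι => p.2.elim (x p.1) (u p.1)) P)
  (hx_ident : ∀ t, IdentDistrib (x t) (x 1) P P)
  (hu_ident : ∀ t n, IdentDistrib (u t n) (u 1 n) P P)
  (hx_pos : ∀ t, ∀ᵐ ω ∂P, 0 < x t ω)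
  {um : ℝ} (hum : 0 < um) (hu_bound : ∀ t n, ∀ᵐ ω ∂P, 0 ≤ u t n ω ∧ u t n ω ≤ um)
  {best : ι} (h_best : ∀ n, n ≠ best → meanDelay P u best < meanDelay P u n)
  (hxm : xm ≤ xp) (h_low : 0 < P {ω | x 1 ω ≤ xm})
  (h_tie : ∀ t S, S.Nonempty → tie t S ∈ S)

include hx_meas hu_meas

omit [DecidableEq ι] [IsProbabilityMeasure P] in
theorem measurableSet_bestMeanError (um : ℝ) (best : ι) (ε : ℝ) (t : ℕ) :
    MeasurableSet (bestMeanError P tie xm xp x u um best ε t) :=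
  measurableSet_le measurable_const
    (((measurable_run tie (2 * um ^ 2) xm xp x u mΩ t (fun s _ => hx_meas s)
      (fun s _ => hu_meas s) best).2.1.sub_const _).abs)

theorem integrable_errorCount (um : ℝ) (best n : ι) (T : ℕ) :
    Integrable (errorCount P tie xm xp x u um best n T) P := by
  unfold errorCount
  refine Integrable.add (Integrable.add (integrable_const _) ?_) ?_
  · exact integrable_finsetSum _ fun j _ => (integrable_const (1 : ℝ)).indicator
      (measurableSet_deviation P tie _ xm xp hx_meas hu_meas n j _ T)
  · exact integrable_finsetSum _ fun t _ => (integrable_const (1 : ℝ)).indicator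
      (measurableSet_bestMeanError P tie hx_meas hu_meas um best _ t)

include h_indep hx_ident hu_ident hx_pos hum hu_bound h_best hxm h_low h_tie

theorem exists_integral_errorCount_le {n : ι} (hn : n ≠ best) :
    ∃ C, ∀ T, ∫ ω, errorCount P tie xm xp x u um best n T ω ∂P ≤ C := by
  set c := (meanDelay P u n - meanDelay P u best) / 4 with hc
  have hc0 : 0 < c := by have := h_best n hn; rw [hc]; linarith
  have hs1 : Summable fun j : ℕ => 2 * Real.exp (-(2 * c ^ 2 / um ^ 2 * j)) := by
    have h := Real.summable_pow_mul_exp_neg_nat_mul 0 (r := 2 * c ^ 2 / um ^ 2) (by positivity)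
    refine (h.mul_left 2).congr fun t => ?_
    rw [pow_zero, one_mul, neg_mul]
  have hs2 := summable_best_mean_error P tie hx_meas hu_meas h_indep hx_ident hu_ident hx_pos hum
    hu_bound h_best hxm h_low h_tie hc0
  refine ⟨Fintype.card ι + ∑' j : ℕ, 2 * Real.exp (-(2 * c ^ 2 / um ^ 2 * j)) +
    ∑' t, P.real (bestMeanError P tie xm xp x u um best c t), fun T => ?_⟩
  have hi1 : ∀ j, Integrable ((deviation P tie (2 * um ^ 2) xm xp x u n j c T).indicator
      (1 : Ω → ℝ)) P := fun j => (integrable_const (1 : ℝ)).indicator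
      (measurableSet_deviation P tie _ xm xp hx_meas hu_meas n j c T)
  have hi2 : ∀ t, Integrable ((bestMeanError P tie xm xp x u um best c t).indicator
      (1 : Ω → ℝ)) P := fun t => (integrable_const (1 : ℝ)).indicator
      (measurableSet_bestMeanError P tie hx_meas hu_meas um best c t)
  have hf1 : Integrable (fun ω => ∑ j ∈ Finset.range T,
      (deviation P tie (2 * um ^ 2) xm xp x u n j c T).indicator (1 : Ω → ℝ) ω) P :=
    integrable_finsetSum _ fun j _ => hi1 j
  have hf2 : Integrable (fun ω => ∑ t ∈ Finset.range T,
      (bestMeanError P tie xm xp x u um best c t).indicator (1 : Ω → ℝ) ω) P :=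
    integrable_finsetSum _ fun t _ => hi2 t
  have hN : Integrable (fun _ : Ω => (Fintype.card ι : ℝ)) P := integrable_const _
  simp only [errorCount, ← hc]
  rw [integral_add (f := fun ω => (Fintype.card ι : ℝ) + ∑ j ∈ Finset.range T,
      (deviation P tie (2 * um ^ 2) xm xp x u n j c T).indicator (1 : Ω → ℝ) ω) (hN.add hf1) hf2,
    integral_add hN hf1,
    integral_finsetSum _ fun j _ => hi1 j, integral_finsetSum _ fun t _ => hi2 t]
  refine add_le_add (add_le_add (by simp) ?_) ?_
  · refine le_trans (Finset.sum_le_sum fun j _ => ?_)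
      (hs1.sum_le_tsum (Finset.range T) fun j _ => by positivity)
    rw [integral_indicator_one (measurableSet_deviation P tie _ xm xp hx_meas hu_meas n j c T)]
    exact measureReal_deviation_le P tie _ xm xp hx_meas hu_meas h_indep hu_ident hum hu_bound
      n j hc0.le T
  · refine le_trans (Finset.sum_le_sum fun t _ => ?_)
      (hs2.sum_le_tsum (Finset.range T) fun t _ => measureReal_nonneg)
    rw [integral_indicator_one (measurableSet_bestMeanError P tie hx_meas hu_meas um best c t)]

theorem exists_expectedCount_le {n : ι} (hn : n ≠ best) :
    ∃ C, ∀ T, expectedCount P tie (2 * um ^ 2) xm xp x u T n ≤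
      8 * Real.log T / gap P u um best n ^ 2 + C := by
  obtain ⟨C, hC⟩ := exists_integral_errorCount_le P tie hx_meas hu_meas h_indep hx_ident hu_ident
    hx_pos hum hu_bound h_best hxm h_low h_tie hn
  have hx : ∀ᵐ ω ∂P, ∀ t, 0 < x (t + 1) ω := ae_all_iff.2 fun t => hx_pos (t + 1)
  refine ⟨C + 1, fun T => ?_⟩
  have hint := integrable_errorCount P tie (xm := xm) (xp := xp) hx_meas hu_meas um best n T
  have h : expectedCount P tie (2 * um ^ 2) xm xp x u T n ≤
      ∫ ω, (errorCount P tie xm xp x u um best n T ω +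
        (8 * Real.log T / gap P u um best n ^ 2 + 1)) ∂P := by
    refine integral_mono_of_nonneg (Filter.Eventually.of_forall fun ω => Nat.cast_nonneg _)
      (hint.add (integrable_const _)) ?_
    filter_upwards [hx] with ω hω
    exact run_k_le_errorCount P tie hum h_best h_tie hω hn T
  rw [integral_add hint (integrable_const _)] at h
  simp only [integral_const, probReal_univ, one_smul] at h
  linarith [hC T]

end Expectation

/-! ### Independence of choices, sizes and delays -/

section Regret

variable {ι : Type*} [Fintype ι] [DecidableEq ι] {Ω : Type*} [mΩ : MeasurableSpace Ω]
  (P : Measure Ω) [IsProbabilityMeasure P] (tie : ℕ → Finset ι → ι) (β xm xp : ℝ)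
  {x : ℕ → Ω → ℝ} {u : ℕ → ι → Ω → ℝ}

/-- The event that service vehicle `n` is used in period `t + 1`. -/
def useEvent (x : ℕ → Ω → ℝ) (u : ℕ → ι → Ω → ℝ) (n : ι) (t : ℕ) : Set Ω :=
  {ω | action tie β xm xp (fun s => x s ω) (fun s i => u s i ω) (t + 1) = n}

omit [DecidableEq ι] mΩ in
theorem measurableSet_useEvent (m : MeasurableSpace Ω) (n : ι) (t : ℕ)
    (hx : ∀ s ≤ t + 1, Measurable (x s)) (hu : ∀ s ≤ t, ∀ i, Measurable (u s i)) :
    MeasurableSet (useEvent tie β xm xp x u n t) :=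
  measurableSet_action_eq tie β xm xp x u m t hx hu n

variable (hx_meas : ∀ t, Measurable (x t)) (hu_meas : ∀ t n, Measurable (u t n))
  (h_indep : iIndepFun (fun p : ℕ × Option ι => p.2.elim (x p.1) (u p.1)) P)
  (hx_ident : ∀ t, IdentDistrib (x t) (x 1) P P)
  (hu_ident : ∀ t n, IdentDistrib (u t n) (u 1 n) P P)

include hx_meas hu_meas h_indep

omit [Fintype ι] [DecidableEq ι] [IsProbabilityMeasure P] in
theorem indepFun_of_measurable_info {S T : Set (ℕ × Option ι)} (hST : Disjoint S T)
    {f g : Ω → ℝ} (hf : Measurable[info x u S] f) (hg : Measurable[info x u T] g) :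
    IndepFun f g P := by
  rw [IndepFun_iff_Indep]
  exact indep_of_indep_of_le_left (indep_of_indep_of_le_right
    (indep_info hx_meas hu_meas h_indep hST) hg.comap_le) hf.comap_le

omit [DecidableEq ι] in
include hu_ident in
/-- The delay of `n` in a period is independent of the event that `n` is used then and of the
task size. -/
theorem integral_use_mul_delay {um : ℝ}
    (hu_bound : ∀ t n, ∀ᵐ ω ∂P, 0 ≤ u t n ω ∧ u t n ω ≤ um) (n : ι) (t : ℕ)
    (hint : Integrable (x (t + 1)) P) (c : ℝ) :
    Integrable (fun ω => (useEvent tie β xm xp x u n t).indicator (x (t + 1)) ω *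
      (u (t + 1) n ω - c)) P ∧
    ∫ ω, (useEvent tie β xm xp x u n t).indicator (x (t + 1)) ω * (u (t + 1) n ω - c) ∂P =
      (∫ ω, (useEvent tie β xm xp x u n t).indicator (x (t + 1)) ω ∂P) *
        (meanDelay P u n - c) := by
  set S : Set (ℕ × Option ι) := {p | p.1 ≤ t} ∪ {(t + 1, none)} with hS
  set S' : Set (ℕ × Option ι) := {(t + 1, some n)} with hS'
  have hdisj : Disjoint S S' := by
    rw [Set.disjoint_singleton_right]
    rintro (h | h)
    · exact absurd h (by simp)
    · simp at h
  have hxS : ∀ s ≤ t + 1, Measurable[info x u S] (x s) := by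
    intro s hs
    apply measurable_info_size
    rcases Nat.le_succ_iff.1 hs with h | rfl
    · exact Or.inl h
    · exact Or.inr rfl
  have huS : ∀ s ≤ t, ∀ i, Measurable[info x u S] (u s i) :=
    fun s hs i => measurable_info_delay x u (Or.inl hs)
  have hf : Measurable[info x u S] ((useEvent tie β xm xp x u n t).indicator (x (t + 1))) :=
    (hxS (t + 1) le_rfl).indicator (measurableSet_useEvent tie β xm xp (info x u S) n t hxS huS)
  have hg : Measurable[info x u S'] fun ω => u (t + 1) n ω - c :=
    (measurable_info_delay x u rfl : Measurable[info x u S'] (u (t + 1) n)).sub_const c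
  have hind := indepFun_of_measurable_info P hx_meas hu_meas h_indep hdisj hf hg
  have hset : MeasurableSet (useEvent tie β xm xp x u n t) :=
    measurableSet_useEvent tie β xm xp mΩ n t (fun s _ => hx_meas s) (fun s _ => hu_meas s)
  have hu_int : Integrable (u (t + 1) n) P := Integrable.of_mem_Icc 0 um
    (hu_meas _ _).aemeasurable (by
      filter_upwards [hu_bound (t + 1) n] with ω h using ⟨h.1, h.2⟩)
  have hfi : Integrable ((useEvent tie β xm xp x u n t).indicator (x (t + 1))) P :=
    hint.indicator hset
  have hgi : Integrable (fun ω => u (t + 1) n ω - c) P := hu_int.sub (integrable_const c)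
  refine ⟨hind.integrable_mul hfi hgi, ?_⟩
  rw [hind.integral_fun_mul_eq_mul_integral hfi.aestronglyMeasurable hgi.aestronglyMeasurable,
    integral_sub hu_int (integrable_const c), integral_delay P hu_ident]
  simp

include hx_ident in
omit [DecidableEq ι] in
/-- Among the tasks whose size lies in a class `B` of constant normalized size, the size of a task
is independent of the choice of the service vehicle. -/
theorem integral_use_size (n : ι) (t : ℕ) {B : Set ℝ} (hB : MeasurableSet B) {z : ℝ}
    (hz : ∀ y ∈ B, normSize xm xp y = z) :
    ∫ ω, (useEvent tie β xm xp x u n t ∩ x (t + 1) ⁻¹' B).indicator (x (t + 1)) ω ∂P =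
      (∫ ω in x 1 ⁻¹' B, x 1 ω ∂P) / P.real (x 1 ⁻¹' B) *
        P.real (useEvent tie β xm xp x u n t ∩ x (t + 1) ⁻¹' B) := by
  set S : Set (ℕ × Option ι) := {p | p.1 ≤ t} with hS
  set S' : Set (ℕ × Option ι) := {(t + 1, none)} with hS'
  have hdisj : Disjoint S S' := by
    rw [Set.disjoint_singleton_right]
    simp [hS]
  set V : Set Ω := {ω | tie (t + 1) (candidates β (t + 1) z
    (run tie β xm xp (fun s => x s ω) (fun s i => u s i ω) t)) = n} with hV
  -- Within the class, the choice is a function of the past alone.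
  have hVeq : useEvent tie β xm xp x u n t ∩ x (t + 1) ⁻¹' B = V ∩ x (t + 1) ⁻¹' B := by
    ext ω
    refine and_congr_left fun hω => ?_
    have h := hz _ hω
    simp only [useEvent, action, hV, Set.mem_ofPred_eq, h, Nat.add_sub_cancel]
  have hrun := measurable_run tie β xm xp x u (info x u S) t
    (fun s hs => measurable_info_size x u hs) (fun s hs i => measurable_info_delay x u hs)
  have hVS : MeasurableSet[info x u S] V :=
    @measurableSet_tie_candidates _ _ _ (info x u S) tie β (t + 1) _ measurable_const _
      (fun i => (hrun i).1) (fun i => (hrun i).2.1) (fun i => (hrun i).2.2) n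
  have hxS' : Measurable[info x u S'] (x (t + 1)) := measurable_info_size x u rfl
  have hVm : MeasurableSet V := info_le hx_meas hu_meas S _ hVS
  have hBm : MeasurableSet (x (t + 1) ⁻¹' B) := hx_meas (t + 1) hB
  have hPB : P.real (x (t + 1) ⁻¹' B) = P.real (x 1 ⁻¹' B) := by
    rw [measureReal_def, measureReal_def, (hx_ident (t + 1)).measure_mem_eq hB]
  have hEB : ∫ ω, (x (t + 1) ⁻¹' B).indicator (x (t + 1)) ω ∂P = ∫ ω in x 1 ⁻¹' B, x 1 ω ∂P := by
    rw [← integral_indicator (hx_meas 1 hB)]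
    exact ((hx_ident (t + 1)).comp (measurable_id.indicator hB)).integral_eq
  have hind : IndepFun (V.indicator fun _ => (1 : ℝ)) ((x (t + 1) ⁻¹' B).indicator (x (t + 1))) P :=
    indepFun_of_measurable_info P hx_meas hu_meas h_indep hdisj
      (measurable_const.indicator hVS) (hxS'.indicator (hxS' hB))
  have hprob : P.real (V ∩ x (t + 1) ⁻¹' B) = P.real V * P.real (x 1 ⁻¹' B) := by
    rw [← hPB, measureReal_def, measureReal_def, measureReal_def, ← ENNReal.toReal_mul]
    rw [(Indep_iff _ _ P).1 (indep_info hx_meas hu_meas h_indep hdisj) V (x (t + 1) ⁻¹' B) hVS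
      (hxS' hB)]
  have hprod : ∀ ω, (V ∩ x (t + 1) ⁻¹' B).indicator (x (t + 1)) ω =
      V.indicator (fun _ => (1 : ℝ)) ω * (x (t + 1) ⁻¹' B).indicator (x (t + 1)) ω := by
    intro ω
    by_cases h1 : ω ∈ V <;> by_cases h2 : ω ∈ x (t + 1) ⁻¹' B <;>
      simp [h1, h2, -Set.mem_preimage]
  rw [hVeq, hprob]
  simp_rw [hprod]
  rw [hind.integral_fun_mul_eq_mul_integral (by fun_prop) (by fun_prop), hEB,
    integral_indicator_const _ hVm, smul_eq_mul, mul_one]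
  -- If the class has probability zero, then the quotient is `0`, and so is the integral.
  by_cases hp : P.real (x 1 ⁻¹' B) = 0
  · have h0 : P (x 1 ⁻¹' B) = 0 := by
      rwa [measureReal_eq_zero_iff] at hp
    rw [Measure.restrict_eq_zero.2 h0]
    simp
  · field_simp

end Regret

/-! ### The learning regret -/

section RegretBound

variable {ι : Type*} [Fintype ι] [DecidableEq ι] {Ω : Type*} [mΩ : MeasurableSpace Ω]
  (P : Measure Ω) [IsProbabilityMeasure P] (tie : ℕ → Finset ι → ι)
  {x : ℕ → Ω → ℝ} {u : ℕ → ι → Ω → ℝ}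
  (hx_meas : ∀ t, Measurable (x t)) (hu_meas : ∀ t n, Measurable (u t n))
  (h_indep : iIndepFun (fun p : ℕ × Option ι => p.2.elim (x p.1) (u p.1)) P)
  (hx_ident : ∀ t, IdentDistrib (x t) (x 1) P P)
  (hu_ident : ∀ t n, IdentDistrib (u t n) (u 1 n) P P)

include hx_meas hu_meas

omit [DecidableEq ι] in
theorem measurableSet_useEvent_inter (β xm xp : ℝ) (n : ι) (t : ℕ) {B : Set ℝ}
    (hB : MeasurableSet B) :
    MeasurableSet (useEvent tie β xm xp x u n t ∩ x (t + 1) ⁻¹' B) :=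
  (measurableSet_useEvent tie β xm xp mΩ n t (fun s _ => hx_meas s) (fun s _ => hu_meas s)).inter
    (hx_meas (t + 1) hB)

theorem sum_measureReal_use_le_expectedCount (β xm xp : ℝ) (n : ι) {B : Set ℝ}
    (hB : MeasurableSet B) (T : ℕ) :
    ∑ t ∈ Finset.range T, P.real (useEvent tie β xm xp x u n t ∩ x (t + 1) ⁻¹' B) ≤
      expectedCount P tie β xm xp x u T n := by
  have hm := fun t => measurableSet_useEvent_inter tie hx_meas hu_meas β xm xp n t hB
  have hk := (measurable_run tie β xm xp x u mΩ T (fun s _ => hx_meas s)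
    (fun s _ => hu_meas s) n).1
  have hkm : Measurable fun ω =>
      ((run tie β xm xp (fun s => x s ω) (fun s i => u s i ω) T).k n : ℝ) :=
    measurable_from_nat.comp hk
  have hki : Integrable (fun ω =>
      ((run tie β xm xp (fun s => x s ω) (fun s i => u s i ω) T).k n : ℝ)) P :=
    Integrable.of_mem_Icc 0 T hkm.aemeasurable (Filter.Eventually.of_forall fun ω =>
      ⟨Nat.cast_nonneg _, by exact_mod_cast run_k_le _ _ _ _ _ _ _ _⟩)
  have hi : ∀ t, Integrable ((useEvent tie β xm xp x u n t ∩ x (t + 1) ⁻¹' B).indicator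
      (1 : Ω → ℝ)) P := fun t => (integrable_const (1 : ℝ)).indicator (hm t)
  simp_rw [← fun t => integral_indicator_one (μ := P) (hm t)]
  rw [← integral_finsetSum _ fun t _ => hi t]
  refine integral_mono (integrable_finsetSum _ fun t _ => hi t) hki fun ω => ?_
  have h := sum_uses tie β xm xp (fun s => x s ω) (fun s i => u s i ω) (fun _ => 1) n T
  rw [Finset.sum_const, Finset.card_range, nsmul_eq_mul, mul_one] at h
  simp only
  rw [← h]
  refine Finset.sum_le_sum fun t _ => ?_
  by_cases hω : action tie β xm xp (fun s => x s ω) (fun s i => u s i ω) (t + 1) = n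
  · rw [if_pos hω]
    exact Set.indicator_le_self' (fun _ _ => zero_le_one) ω
  · rw [if_neg hω, Set.indicator_of_notMem fun h => hω h.1]

include h_indep hx_ident hu_ident

theorem regret_eq (β xm xp : ℝ) {um : ℝ}
    (hu_bound : ∀ t n, ∀ᵐ ω ∂P, 0 ≤ u t n ω ∧ u t n ω ≤ um) (best : ι)
    (hint : Integrable (x 1) P) (T : ℕ) :
    regret P tie β xm xp x u best T =
      ∑ n ∈ Finset.univ.erase best, (meanDelay P u n - meanDelay P u best) *
        ∑ t ∈ Finset.range T, ∫ ω, (useEvent tie β xm xp x u n t).indicator (x (t + 1)) ω ∂P := by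
  have hint' : ∀ t, Integrable (x t) P := fun t => (hx_ident t).integrable_iff.2 hint
  have hstep := fun n t => integral_use_mul_delay P tie β xm xp hx_meas hu_meas h_indep hu_ident
    hu_bound n t (hint' (t + 1)) (meanDelay P u best)
  have hshift : ∀ (f : ℕ → ℝ), ∑ t ∈ Finset.Icc 1 T, f t = ∑ t ∈ Finset.range T, f (t + 1) := by
    intro f
    induction T with
    | zero => simp
    | succ T ih => rw [Finset.sum_Icc_succ_top (by omega), ih, Finset.sum_range_succ]
  have hpt : ∀ ω, (∑ t ∈ Finset.Icc 1 T, x t ω *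
      (u t (action tie β xm xp (fun t => x t ω) (fun t m => u t m ω) t) ω - meanDelay P u best)) =
      ∑ t ∈ Finset.range T, ∑ n, (useEvent tie β xm xp x u n t).indicator (x (t + 1)) ω *
        (u (t + 1) n ω - meanDelay P u best) := by
    intro ω
    rw [hshift]
    refine Finset.sum_congr rfl fun t _ => ?_
    rw [Finset.sum_eq_single_of_mem
      (action tie β xm xp (fun t => x t ω) (fun t m => u t m ω) (t + 1)) (Finset.mem_univ _)]
    · have h : ω ∈ useEvent tie β xm xp x u
          (action tie β xm xp (fun t => x t ω) (fun t m => u t m ω) (t + 1)) t := rfl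
      rw [Set.indicator_of_mem h]
    · intro n _ hn
      have h : ω ∉ useEvent tie β xm xp x u n t := fun h => hn (Eq.symm h)
      rw [Set.indicator_of_notMem h, zero_mul]
  rw [regret]
  simp_rw [hpt]
  rw [integral_finsetSum _ fun t _ => integrable_finsetSum _ fun n _ => (hstep n t).1]
  simp_rw [fun t => integral_finsetSum Finset.univ fun n _ => (hstep n t).1,
    fun n t => (hstep n t).2]
  rw [Finset.sum_comm, ← Finset.sum_erase_add _ _ (Finset.mem_univ best)]
  simp only [sub_self, mul_zero, Finset.sum_const_zero, add_zero]
  refine Finset.sum_congr rfl fun n _ => ?_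
  rw [Finset.mul_sum]
  exact Finset.sum_congr rfl fun t _ => mul_comm _ _

omit [DecidableEq ι] hu_ident in
/-- With equal thresholds there are two size classes, small and large; in each of them the expected
total size of the tasks offloaded to `n` is the expected number of these tasks times the mean size
of the class. -/
theorem sum_integral_use_eq (β xm : ℝ) (hint : Integrable (x 1) P) (n : ι) (T : ℕ) :
    ∑ t ∈ Finset.range T, ∫ ω, (useEvent tie β xm xm x u n t).indicator (x (t + 1)) ω ∂P =
      (∫ ω, x 1 ω ∂(ProbabilityTheory.cond P {ω | x 1 ω ≤ xm})) *
        ∑ t ∈ Finset.range T, P.real (useEvent tie β xm xm x u n t ∩ x (t + 1) ⁻¹' Set.Iic xm) +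
      (∫ ω in x 1 ⁻¹' Set.Ioi xm, x 1 ω ∂P) / P.real (x 1 ⁻¹' Set.Ioi xm) *
        ∑ t ∈ Finset.range T, P.real (useEvent tie β xm xm x u n t ∩ x (t + 1) ⁻¹' Set.Ioi xm)
      := by
  have hcond : ∫ ω, x 1 ω ∂(ProbabilityTheory.cond P {ω | x 1 ω ≤ xm}) =
      (∫ ω in x 1 ⁻¹' Set.Iic xm, x 1 ω ∂P) / P.real (x 1 ⁻¹' Set.Iic xm) := by
    rw [ProbabilityTheory.cond, integral_smul_measure, ENNReal.toReal_inv, smul_eq_mul, mul_comm]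
    rfl
  rw [hcond, Finset.mul_sum, Finset.mul_sum, ← Finset.sum_add_distrib]
  refine Finset.sum_congr rfl fun t _ => ?_
  have h1 := integral_use_size P tie β xm xm hx_meas hu_meas h_indep hx_ident n t
    measurableSet_Iic (z := 0) (fun y hy => normSize_of_le le_rfl hy)
  have h2 := integral_use_size P tie β xm xm hx_meas hu_meas h_indep hx_ident n t
    measurableSet_Ioi (z := 1) (fun y hy => by
      rw [normSize, if_pos rfl, if_neg (not_le.2 hy)])
  have hi : Integrable (x (t + 1)) P := (hx_ident (t + 1)).integrable_iff.2 hint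
  rw [← h1, ← h2, ← integral_add
    (hi.indicator (measurableSet_useEvent_inter tie hx_meas hu_meas β xm xm n t measurableSet_Iic))
    (hi.indicator (measurableSet_useEvent_inter tie hx_meas hu_meas β xm xm n t measurableSet_Ioi))]
  refine integral_congr_ae (Filter.Eventually.of_forall fun ω => ?_)
  by_cases h : ω ∈ useEvent tie β xm xm x u n t
  · rcases le_or_gt (x (t + 1) ω) xm with h' | h'
    · simp [h, h', not_lt.2 h']
    · simp [h, h', not_le.2 h']
  · simp [h]

variable (hx_pos : ∀ t, ∀ᵐ ω ∂P, 0 < x t ω)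
  {um : ℝ} (hum : 0 < um) (hu_bound : ∀ t n, ∀ᵐ ω ∂P, 0 ≤ u t n ω ∧ u t n ω ≤ um)
  {best : ι} (h_best : ∀ n, n ≠ best → meanDelay P u best < meanDelay P u n)
  {xm : ℝ} (h_low : 0 < P {ω | x 1 ω ≤ xm})
  (h_tie : ∀ t S, S.Nonempty → tie t S ∈ S)

include hx_pos hum hu_bound h_best h_low h_tie

/-- For a large task the algorithm follows the averages greedily; this happens at the expense of a
suboptimal service vehicle only boundedly often in expectation. -/
theorem exists_sum_measureReal_use_large_le {n : ι} (hn : n ≠ best) :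
    ∃ C, ∀ T, ∑ t ∈ Finset.range T,
      P.real (useEvent tie (2 * um ^ 2) xm xm x u n t ∩ x (t + 1) ⁻¹' Set.Ioi xm) ≤ C := by
  obtain ⟨C, hC⟩ := exists_integral_errorCount_le P tie hx_meas hu_meas h_indep hx_ident hu_ident
    hx_pos hum hu_bound h_best le_rfl h_low h_tie hn
  have hx : ∀ᵐ ω ∂P, ∀ t, 0 < x (t + 1) ω := ae_all_iff.2 fun t => hx_pos (t + 1)
  refine ⟨C, fun T => le_trans ?_ (hC T)⟩
  have hm := fun t => measurableSet_useEvent_inter tie hx_meas hu_meas (2 * um ^ 2) xm xm n t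
    (measurableSet_Ioi (a := xm))
  have hi : ∀ t, Integrable ((useEvent tie (2 * um ^ 2) xm xm x u n t ∩
      x (t + 1) ⁻¹' Set.Ioi xm).indicator (1 : Ω → ℝ)) P :=
    fun t => (integrable_const (1 : ℝ)).indicator (hm t)
  simp_rw [← fun t => integral_indicator_one (μ := P) (hm t)]
  rw [← integral_finsetSum _ fun t _ => hi t]
  refine integral_mono_ae (integrable_finsetSum _ fun t _ => hi t)
    (integrable_errorCount P tie hx_meas hu_meas um best n T) ?_
  filter_upwards [hx] with ω hω
  refine le_trans (Finset.sum_le_sum fun t _ => ?_)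
    (card_unexplained_uses_le P tie hum h_best h_tie hω hn T)
  by_cases h : ω ∈ useEvent tie (2 * um ^ 2) xm xm x u n t ∩ x (t + 1) ⁻¹' Set.Ioi xm
  · have hz : normSize xm xm (x (t + 1) ω) = 1 := by
      rw [normSize, if_pos rfl, if_neg (not_le.2 h.2)]
    rw [Set.indicator_of_mem h, if_pos ⟨h.1, fun h' => absurd h'.1 (by rw [hz]; exact lt_irrefl 1)⟩]
    exact le_rfl
  · rw [Set.indicator_of_notMem h]
    split_ifs <;> simp

theorem exists_regret_le (hint : Integrable (x 1) P) :
    ∃ C : ι → ℝ, ∀ T : ℕ, regret P tie (2 * um ^ 2) xm xm x u best T ≤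
      um * ∑ n ∈ Finset.univ.erase best,
        (8 * Real.log T * (∫ ω, x 1 ω ∂(ProbabilityTheory.cond P {ω | x 1 ω ≤ xm}))
          / gap P u um best n + C n) := by
  have h1 : ∀ n, ∃ C, n ≠ best → ∀ T, expectedCount P tie (2 * um ^ 2) xm xm x u T n ≤
      8 * Real.log T / gap P u um best n ^ 2 + C := by
    intro n
    by_cases hn : n = best
    · exact ⟨0, fun h => absurd hn h⟩
    · obtain ⟨C, hC⟩ := exists_expectedCount_le P tie hx_meas hu_meas h_indep hx_ident hu_ident
        hx_pos hum hu_bound h_best le_rfl h_low h_tie hn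
      exact ⟨C, fun _ => hC⟩
  have h2 : ∀ n, ∃ C, n ≠ best → ∀ T, ∑ t ∈ Finset.range T,
      P.real (useEvent tie (2 * um ^ 2) xm xm x u n t ∩ x (t + 1) ⁻¹' Set.Ioi xm) ≤ C := by
    intro n
    by_cases hn : n = best
    · exact ⟨0, fun h => absurd hn h⟩
    · obtain ⟨C, hC⟩ := exists_sum_measureReal_use_large_le P tie hx_meas hu_meas h_indep hx_ident
        hu_ident hx_pos hum hu_bound h_best h_low h_tie hn
      exact ⟨C, fun _ => hC⟩
  choose C₁ hC₁ using h1
  choose C₂ hC₂ using h2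
  set E := ∫ ω, x 1 ω ∂(ProbabilityTheory.cond P {ω | x 1 ω ≤ xm}) with hE
  set D := (∫ ω in x 1 ⁻¹' Set.Ioi xm, x 1 ω ∂P) / P.real (x 1 ⁻¹' Set.Ioi xm) with hD
  have hE0 : 0 ≤ E := by
    refine integral_nonneg_of_ae ?_
    filter_upwards [cond_absolutelyContinuous.ae_le (hx_pos 1)] with ω h using h.le
  have hD0 : 0 ≤ D := by
    refine div_nonneg (integral_nonneg_of_ae ?_) measureReal_nonneg
    filter_upwards [ae_restrict_of_ae (hx_pos 1)] with ω h using h.le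
  refine ⟨fun n => gap P u um best n * (E * C₁ n + D * C₂ n), fun T => ?_⟩
  rw [regret_eq P tie hx_meas hu_meas h_indep hx_ident hu_ident _ xm xm hu_bound best hint T,
    Finset.mul_sum]
  refine Finset.sum_le_sum fun n hn => ?_
  have hn' : n ≠ best := Finset.ne_of_mem_erase hn
  have hg := gap_pos P u hum h_best hn'
  have hgap : meanDelay P u n - meanDelay P u best = um * gap P u um best n := by
    rw [gap]; field_simp
  rw [sum_integral_use_eq P tie hx_meas hu_meas h_indep hx_ident _ xm hint n T, hgap, ← hE, ← hD]
  have hsmall := (sum_measureReal_use_le_expectedCount P tie hx_meas hu_meas (2 * um ^ 2) xm xm n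
    (measurableSet_Iic (a := xm)) T).trans (hC₁ n hn' T)
  have hlarge := hC₂ n hn' T
  calc _ ≤ um * gap P u um best n *
        (E * (8 * Real.log T / gap P u um best n ^ 2 + C₁ n) + D * C₂ n) := by gcongr
    _ = _ := by field_simp; ring

end RegretBound

end AVUCB

end

theorem theorem2 {ι : Type*} [Fintype ι] [DecidableEq ι]
    {Ω : Type*} [MeasurableSpace Ω] (P : Measure Ω) [IsProbabilityMeasure P]
    (x : ℕ → Ω → ℝ) (u : ℕ → ι → Ω → ℝ)
    (hx_meas : ∀ t, Measurable (x t)) (hu_meas : ∀ t n, Measurable (u t n))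
    -- all task sizes and all bit offloading delays are independent
    (h_indep : iIndepFun (fun p : ℕ × Option ι => p.2.elim (x p.1) (u p.1)) P)
    -- identically distributed over time
    (hx_ident : ∀ t, IdentDistrib (x t) (x 1) P P)
    (hu_ident : ∀ t n, IdentDistrib (u t n) (u 1 n) P P)
    (hx_pos : ∀ t, ∀ᵐ ω ∂P, 0 < x t ω)
    (um : ℝ) (hum : 0 < um) (hu_bound : ∀ t n, ∀ᵐ ω ∂P, 0 ≤ u t n ω ∧ u t n ω ≤ um)
    -- the single best service vehicle
    (best : ι)
    (h_best : ∀ n, n ≠ best → AVUCB.meanDelay P u best < AVUCB.meanDelay P u n)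
    (xm xp : ℝ) (h_low : 0 < P {ω | x 1 ω ≤ xm})
    -- an arbitrary rule for breaking ties and ordering the initial connections
    (tie : ℕ → Finset ι → ι) (h_tie : ∀ t S, S.Nonempty → tie t S ∈ S) :
    (xm ≤ xp → ∀ n, n ≠ best → ∃ C : ℝ, ∀ T : ℕ, 1 ≤ T →
      AVUCB.expectedCount P tie (2 * um ^ 2) xm xp x u T n
        ≤ 8 * Real.log T / AVUCB.gap P u um best n ^ 2 + C) ∧
    (xp = xm → Integrable (x 1) P → ∃ C : ι → ℝ, ∀ T : ℕ, 1 ≤ T →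
      AVUCB.regret P tie (2 * um ^ 2) xm xp x u best T
        ≤ um * ∑ n ∈ Finset.univ.erase best,
            (8 * Real.log T * (∫ ω, x 1 ω ∂(ProbabilityTheory.cond P {ω | x 1 ω ≤ xm}))
              / AVUCB.gap P u um best n + C n)) := by
  refine ⟨fun hxm n hn => ?_, fun hxp hint => ?_⟩
  · obtain ⟨C, hC⟩ := AVUCB.exists_expectedCount_le P tie hx_meas hu_meas h_indep hx_ident hu_ident
      hx_pos hum hu_bound h_best hxm h_low h_tie hn
    exact ⟨C, fun T _ => hC T⟩
  · subst hxp
    obtain ⟨C, hC⟩ := AVUCB.exists_regret_le P tie hx_meas hu_meas h_indep hx_ident hu_ident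
      hx_pos hum hu_bound h_best h_low h_tie hint
    exact ⟨C, fun T _ => hC T⟩
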